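/- Let $O=(0,0)$ be the origin of an affine chart $\mathbb{C}^2\subset\mathbb{P}^2$ with coordinates $(x,y)$, and let $R=x\partial_x+y\partial_y$. Let $\mathcal F$ be a (not necessarily saturated) foliation of degree $3$ on $\mathbb{P}^2$ given in this chart by a vector field $X=X_3+H\cdot R$, where $X_3=A\,\partial_x+B\,\partial_y$ with $A,B$ homogeneous polynomials of degree $3$ and $H$ is a homogeneous polynomial of degree $3$ (or zero). Assume that the singular set of $X_3$ has no multiple components, i.e. no square of a nonconstant polynomial divides both $A$ and $B$. Let $\mathcal F_h$ be the homogeneous foliation of degree $3$ given by $X_3$. For a degree $3$ foliation $\mathcal G$ given by $a\,\partial_x+b\,\partial_y$ in the chart, let $\mathrm{Leg}\,\mathcal G$ be its Legendre transform: the $3$-web on the dual plane $\check{\mathbb P}^2$ which, in the affine coordinates $(p,q)$ standing for the line $y=px+q$, is given by the implicit differential equation $b(x,px+q)-p\,a(x,px+q)=0$ with $x=-\frac{dq}{dp}$ (regarded as a binary cubic form in $(dp,dq)$). For a $3$-web $\mathcal W$ given locally, off its discriminant, by $\omega_1\omega_2\omega_3=0$ with pairwise independent holomorphic $1$-forms $\omega_i$,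 write $\omega_i\wedge\omega_j=\delta_{ij}\,dp\wedge dq$; the curvature of $\mathcal W$ is the $2$-form $K(\mathcal W)=d\eta$, where $\eta$ is the unique $1$-form with $d(\delta_{ij}\omega_k)=\delta_{ij}\,\omega_k\wedge\eta$ for every cyclic permutation $(i,j,k)$ of $(1,2,3)$. It is said to be holomorphic at a point $m$ if it is, near $m$ and off the discriminant, the restriction of a holomorphic $2$-form defined near $m$. Let $\check O$ be the dual line of $O$, with equation $q=0$ in the chart $(p,q)$; a property holds at the generic point of $\check O$ if it holds at all but finitely many points of $\check O$. Then $K(\mathrm{Leg}\,\mathcal F)$ is holomorphic at the generic point of $\check O$ if and only if $K(\mathrm{Leg}\,\mathcal F_h)$ is holomorphic at the generic point of $\check O$. -/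

import Mathlib

open scoped Topology Matrix

/-- A (possibly non-saturated) foliation of degree `d` on the complex projective plane, presented
by a homogeneous vector field `V₀ ∂_x + V₁ ∂_y + V₂ ∂_z` on `ℂ³` with coefficients of degree `d`.
Through the Euler sequence these present the global sections of `Tℙ²(d - 1)`; adding a multiple of
the radial field `x ∂_x + y ∂_y + z ∂_z` does not change the section. -/
structure PlaneFoliation (d : ℕ) where
  /-- the coefficients of the homogeneous vector field -/
  coeff : Fin 3 → MvPolynomial (Fin 3) ℂ
  homogeneous : ∀ i, (coeff i).IsHomogeneous d

namespace PlaneFoliation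

/-- Dehomogenization: restriction of a polynomial in `x, y, z` to the affine chart `z = 1`. -/
noncomputable def dehomogenize (P : MvPolynomial (Fin 3) ℂ) : MvPolynomial (Fin 2) ℂ :=
  MvPolynomial.aeval ![MvPolynomial.X 0, MvPolynomial.X 1, 1] P

/-- The vector field on the affine chart `(x : y : 1)` to which the homogeneous vector field
projects: `(V₀ - x V₂) ∂_x + (V₁ - y V₂) ∂_y` at `z = 1`. -/
noncomputable def affineField {d : ℕ} (F : PlaneFoliation d) :
    Fin 2 → MvPolynomial (Fin 2) ℂ :=
  ![dehomogenize (F.coeff 0) - MvPolynomial.X 0 * dehomogenize (F.coeff 2),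
    dehomogenize (F.coeff 1) - MvPolynomial.X 1 * dehomogenize (F.coeff 2)]

/-- The foliation is induced, in the affine chart `z = 1`, by the polynomial vector field
`V 0 ∂_x + V 1 ∂_y`; a foliation determines the vector field up to a nonzero constant. -/
def IsInducedBy {d : ℕ} (F : PlaneFoliation d) (V : Fin 2 → MvPolynomial (Fin 2) ℂ) : Prop :=
  ∃ c : ℂ, c ≠ 0 ∧ F.affineField = c • V

/-- The Legendre transform of a foliation of degree `d`, as a `d`-symmetric form on the space `ℂ³`
of homogeneous coordinates `ℓ = (a, b, c)` of the dual plane, where `ℓ` stands for the line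
`a x + b y + c z = 0`. For a tangent vector `v = (da, db, dc)` at `ℓ`, the point `m = ℓ × v` is the
only point of the plane with `⟨ℓ, m⟩ = 0` and `⟨v, m⟩ = 0`; that is, `v` is tangent at `ℓ` to the
dual line of `m ∈ ℓ`. The value of the form is the bihomogeneous polynomial
`a V₀(m) + b V₁(m) + c V₂(m)` of the foliation, which vanishes exactly when the foliation is tangent
to `ℓ` at `m` (or singular at `m`). -/
noncomputable def legendreForm {d : ℕ} (F : PlaneFoliation d) (ℓ v : Fin 3 → ℂ) : ℂ :=
  ∑ i, ℓ i * MvPolynomial.eval (ℓ ⨯₃ v) (F.coeff i)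

/-- The Legendre transform in the affine chart `(p, q)` of the dual plane, where `(p, q)` stands for
the line `y = p x + q`, i.e. `(a, b, c) = (p, -1, q)`. For `v = (dp, dq)` one has
`ℓ × v = (-dq, q dp - p dq, dp) = dp • (x, p x + q, 1)` with `x = -dq/dp`, so that this is the
implicit differential equation `B(x, p x + q) - p A(x, p x + q) = 0`, `x = -dq/dp`, where
`A ∂_x + B ∂_y` is the affine vector field. -/
noncomputable def leg {d : ℕ} (F : PlaneFoliation d) (z v : ℂ × ℂ) : ℂ :=
  F.legendreForm ![z.1, -1, z.2] ![v.1, 0, v.2]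

end PlaneFoliation

namespace PlaneWeb

/-! Coordinates on `ℂ²` are `(p, q)`. A `1`-form `a dp + b dq` is given by the pair `(a, b)` of its
coefficients, a `2`-form `g dp ∧ dq` by its coefficient `g`, and a `k`-symmetric `1`-form by its
values `W z v` on tangent vectors `v = (dp, dq)` at points `z`. -/

/-- The value of the covector `a dp + b dq` on a tangent vector. -/
def apply (α v : ℂ × ℂ) : ℂ := α.1 * v.1 + α.2 * v.2

/-- `α ∧ β` as a multiple of `dp ∧ dq`. -/
def wedge (α β : ℂ × ℂ) : ℂ := α.1 * β.2 - α.2 * β.1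

/-- `d(a dp + b dq) = (∂_p b - ∂_q a) dp ∧ dq`. -/
noncomputable def extD (ω : ℂ × ℂ → ℂ × ℂ) (z : ℂ × ℂ) : ℂ :=
  fderiv ℂ (fun y => (ω y).2) z (1, 0) - fderiv ℂ (fun y => (ω y).1) z (0, 1)

/-- The discriminant of a `k`-web: the set of points at which the symmetric form does not factor as
a product of `k` pairwise linearly independent linear forms. -/
def discriminant (k : ℕ) (W : ℂ × ℂ → ℂ × ℂ → ℂ) : Set (ℂ × ℂ) :=
  {z | ¬ ∃ α : Fin k → ℂ × ℂ, (∀ v, W z v = ∏ i, apply (α i) v) ∧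
    ∀ i j, i ≠ j → wedge (α i) (α j) ≠ 0}

/-- The curvature of the `3`-web `W = 0` at the point `z` is `κ dp ∧ dq`: near `z` the web is
`ω₀ ω₁ ω₂ = 0` with holomorphic pairwise independent `1`-forms `ω_i`; with `δ_{ij} = ω_i ∧ ω_j` one
has `δ₁₂ ω₀ + δ₂₀ ω₁ + δ₀₁ ω₂ = 0`, there is a unique `1`-form `η` with
`d(δ_{jk} ω_i) = δ_{jk} ω_i ∧ η` for the cyclic permutations `(i, j, k)` of `(0, 1, 2)`, and
the curvature is `dη`. (Indices are added modulo `3`.) -/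
def HasCurvatureAt (W : ℂ × ℂ → ℂ × ℂ → ℂ) (z : ℂ × ℂ) (κ : ℂ) : Prop :=
  ∃ (U : Set (ℂ × ℂ)) (ω : Fin 3 → ℂ × ℂ → ℂ × ℂ) (η : ℂ × ℂ → ℂ × ℂ),
    IsOpen U ∧ z ∈ U ∧ (∀ i, AnalyticOnNhd ℂ (ω i) U) ∧ AnalyticOnNhd ℂ η U ∧
    (∀ y ∈ U, ∀ v, W y v = ∏ i, apply (ω i y) v) ∧
    (∀ y ∈ U, ∀ i j, i ≠ j → wedge (ω i y) (ω j y) ≠ 0) ∧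
    (∀ y ∈ U, ∀ i : Fin 3,
      extD (fun t => wedge (ω (i + 1) t) (ω (i + 2) t) • ω i t) y =
        wedge (wedge (ω (i + 1) y) (ω (i + 2) y) • ω i y) (η y)) ∧
    κ = extD η z

/-- The curvature of the `3`-web, which is a `2`-form defined off the discriminant, is holomorphic
at `m`: near `m` it is the restriction of a holomorphic `2`-form `f dp ∧ dq`. -/
def CurvatureHolomorphicAt (W : ℂ × ℂ → ℂ × ℂ → ℂ) (m : ℂ × ℂ) : Prop :=
  ∃ f : ℂ × ℂ → ℂ, AnalyticAt ℂ f m ∧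
    ∀ᶠ z in 𝓝 m, z ∉ discriminant 3 W → HasCurvatureAt W z (f z)

/-- The dual line of the point `s` of the affine plane, in the chart `(p, q)` of the dual plane: the
lines `y = p x + q` that pass through `s`. -/
def dualLine (s : ℂ × ℂ) : Set (ℂ × ℂ) := {z | s.2 = z.1 * s.1 + z.2}

/-- The curvature is holomorphic at the generic point of the curve `C`: at all points of `C` but
finitely many. -/
def CurvatureHolomorphicAtGenericPoint (W : ℂ × ℂ → ℂ × ℂ → ℂ) (C : Set (ℂ × ℂ)) : Prop :=
  {m ∈ C | ¬ CurvatureHolomorphicAt W m}.Finite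

end PlaneWeb

/-- The singular set of the vector field `V 0 ∂_x + V 1 ∂_y` has no multiple components: no square
of a nonconstant polynomial divides both coefficients. -/
def NoMultipleSingularComponents (V : Fin 2 → MvPolynomial (Fin 2) ℂ) : Prop :=
  ∀ L : MvPolynomial (Fin 2) ℂ, (∀ i, L ^ 2 ∣ V i) → IsUnit L

/-! With `N = p a - b - q h` (`a`, `b`, `h` the cubics of `A`, `B`, `H`), the Legendre transform is,
up to a nonzero constant, `N(-dq, q dp - p dq) = q³ N(-dq/q, dp - p dq/q)`
(`PlaneFoliation.leg_eq_radialWeb`, `radialWeb_eq`). So in the logarithmic frame `dp, dq/q` its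
coefficients are holomorphic across `q = 0`, where `h` drops out.

The cubics `a` and `b` have no common multiple root, since this would give a common square factor.
Hence `p a - b` has simple roots for all but finitely many `p` (`finite_pencil_isCriticalPoint`).
Near such a `p` the web is `q³ ∏ (a_i dp + b_i dq/q)` with holomorphic, pairwise independent
factors, so that `η = α dp + β dq/q` with `α`, `β` holomorphic, and `dη = (∂_p β / q - ∂_q α) dp ∧
dq`. The polar part depends only on `β(p, 0)`, which is determined by the factors on `q = 0`
(`logConnection_snd_congr`), hence is the same for all `h`. By Hadamard's lemma two such curvatures
differ by a holomorphic form (`exists_logCurvature_eq_add`), so one is holomorphic exactly when the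
other is. -/

/-! ### Hadamard's lemma in two variables -/

namespace ContinuousMultilinearMap

/-- Replacing `v` by `(v.1, 0)` one slot at a time gives a telescoping sum, and the change in slot
`k` is `v.2` times `P` with `(0, 1)` there. The norm bound keeps the radius of the quotient series
positive. -/
theorem exists_apply_diag_sub_eq_snd_mul {n : ℕ}
    (P : ContinuousMultilinearMap ℂ (fun _ : Fin (n + 1) => ℂ × ℂ) ℂ) :
    ∃ Q : ContinuousMultilinearMap ℂ (fun _ : Fin n => ℂ × ℂ) ℂ,
      ‖Q‖ ≤ (n + 1) * ‖P‖ ∧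
      ∀ v : ℂ × ℂ, P (fun _ => v) - P (fun _ => (v.1, 0)) = v.2 * Q (fun _ => v) := by
  let π : ℂ × ℂ →L[ℂ] ℂ × ℂ :=
    (ContinuousLinearMap.inl ℂ ℂ ℂ).comp (ContinuousLinearMap.fst ℂ ℂ ℂ)
  have hπ : ‖π‖ ≤ 1 := by
    refine ContinuousLinearMap.opNorm_le_bound _ zero_le_one fun v => ?_
    simp [π, Prod.norm_def]
  -- Slots before `k` are already projected, those after `k` are still untouched.
  let L : Fin (n + 1) → Fin n → ℂ × ℂ →L[ℂ] ℂ × ℂ := fun k j =>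
    if (k.succAbove j) < k then π else ContinuousLinearMap.id ℂ _
  have hL : ∀ k j, ‖L k j‖ ≤ 1 := fun k j => by
    by_cases h : (k.succAbove j) < k
    · simpa only [L, h, if_true] using hπ
    · simpa only [L, h, if_false] using ContinuousLinearMap.norm_id_le
  refine ⟨∑ k, (P.curryMid k (0, 1)).compContinuousLinearMap (L k), ?_, fun v => ?_⟩
  · refine (norm_sum_le _ _).trans ?_
    have : ∀ k ∈ (Finset.univ : Finset (Fin (n + 1))),
        ‖(P.curryMid k (0, 1)).compContinuousLinearMap (L k)‖ ≤ ‖P‖ := fun k _ => by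
      refine (norm_compContinuousLinearMap_le _ _).trans ?_
      have h1 : ‖P.curryMid k (0, 1)‖ ≤ ‖P‖ := by
        refine ((P.curryMid k).le_opNorm _).trans ?_
        simp [Prod.norm_def]
      calc _ ≤ ‖P‖ * 1 := by
            gcongr
            exact Finset.prod_le_one (fun _ _ => norm_nonneg _) fun j _ => hL k j
        _ = _ := mul_one _
    simpa using Finset.sum_le_card_nsmul _ _ _ this
  · let T : ℕ → ℂ := fun k => P fun j : Fin (n + 1) => if (j : ℕ) < k then (v.1, 0) else v
    have h0 : P (fun _ => v) = T 0 := by simp [T]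
    have h1 : P (fun _ => (v.1, 0)) = T (n + 1) := by
      refine congrArg P (funext fun j => ?_)
      rw [if_pos j.2]
    have hstep : ∀ k : Fin (n + 1), T k - T (k + 1) =
        v.2 * (P.curryMid k (0, 1)).compContinuousLinearMap (L k) (fun _ => v) := fun k => by
      let m : Fin (n + 1) → ℂ × ℂ := fun j => if (j : ℕ) < k then (v.1, 0) else v
      have e1 : T k = P (Function.update m k v) := by
        refine congrArg P (funext fun j => ?_)
        by_cases h : j = k
        · subst h; simp
        · simp [m, h]
      have e2 : T (k + 1) = P (Function.update m k (v.1, 0)) := by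
        refine congrArg P (funext fun j => ?_)
        by_cases h : j = k
        · subst h; simp
        · have : (j : ℕ) ≠ k := fun h' => h (Fin.ext h')
          simp only [Function.update_of_ne h, m]
          congr 1
          simp only [eq_iff_iff]; omega
      have e3 : v - (v.1, 0) = v.2 • ((0 : ℂ), (1 : ℂ)) := by ext <;> simp
      rw [e1, e2, ← P.map_update_sub, e3, P.map_update_smul, smul_eq_mul]
      congr 1
      simp only [compContinuousLinearMap_apply, curryMid_apply]
      congr 1
      ext1 j
      refine Fin.succAboveCases k ?_ (fun i => ?_) j
      · simp
      · rw [Function.update_of_ne (Fin.succAbove_ne k i), Fin.insertNth_apply_succAbove]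
        by_cases h : k.succAbove i < k
        · simp [m, L, h, π]
        · simp [m, L, h]
    rw [h0, h1, sum_apply, Finset.mul_sum, ← Finset.sum_congr rfl fun k _ => hstep k,
      Fin.sum_univ_eq_sum_range (fun k => T k - T (k + 1)), Finset.sum_range_sub']

end ContinuousMultilinearMap

/-- Hadamard's lemma: an analytic function of two variables that vanishes for `q = 0` is divisible
by `q`. -/
theorem AnalyticAt.exists_eq_snd_mul {f : ℂ × ℂ → ℂ} {p₀ : ℂ} (hf : AnalyticAt ℂ f (p₀, 0))
    (h0 : ∀ᶠ p in 𝓝 p₀, f (p, 0) = 0) :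
    ∃ g : ℂ × ℂ → ℂ, AnalyticAt ℂ g (p₀, 0) ∧ ∀ᶠ z in 𝓝 (p₀, 0), f z = z.2 * g z := by
  obtain ⟨P, hP⟩ := hf
  choose Q hQ hQ' using fun n => (P (n + 1)).exists_apply_diag_sub_eq_snd_mul
  obtain ⟨C, r, hC, hr, hCr⟩ := P.le_mul_pow_of_radius_pos hP.radius_pos
  let q : FormalMultilinearSeries ℂ (ℂ × ℂ) ℂ := Q
  have hrad : 0 < q.radius := by
    -- The extra factor 2 absorbs the `n + 1` of the norm bound, through `n + 1 ≤ 2 ^ n`.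
    let s : NNReal := ⟨(2 * r)⁻¹, by positivity⟩
    have hs : (0 : NNReal) < s := by
      change (0 : ℝ) < (2 * r)⁻¹
      positivity
    refine lt_of_lt_of_le (ENNReal.coe_pos.2 hs) (q.le_radius_of_bound (C * r) fun n => ?_)
    have h2 : ((n : ℝ) + 1) ≤ 2 ^ n := by
      exact_mod_cast Nat.lt_two_pow_self (n := n)
    calc ‖q n‖ * (s : ℝ) ^ n ≤ ((n + 1) * (C * r ^ (n + 1))) * ((2 * r)⁻¹) ^ n := by
          gcongr
          · exact (hQ n).trans (by gcongr; exact hCr _)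
          · exact le_rfl
      _ ≤ (2 ^ n * (C * r ^ (n + 1))) * ((2 * r)⁻¹) ^ n := by gcongr
      _ = C * r := by
          rw [inv_pow, mul_pow, pow_succ]; field_simp
  have hq := q.hasFPowerSeriesOnBall hrad
  obtain ⟨R, hR⟩ := hP
  have hq0 : AnalyticAt ℂ q.sum ((p₀, (0 : ℂ)) - (p₀, 0)) := by
    rw [sub_self]; exact hq.analyticAt
  refine ⟨fun z => q.sum (z - (p₀, 0)),
    AnalyticAt.fun_comp hq0 (analyticAt_id.sub analyticAt_const), ?_⟩
  have t1 : Filter.Tendsto (fun z : ℂ × ℂ => z - (p₀, 0)) (𝓝 (p₀, 0)) (𝓝 0) := by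
    have : ContinuousAt (fun z : ℂ × ℂ => z - (p₀, 0)) (p₀, 0) := by fun_prop
    simpa [ContinuousAt] using this
  have t2 : Filter.Tendsto (fun z : ℂ × ℂ => (z.1 - p₀, (0 : ℂ))) (𝓝 (p₀, 0)) (𝓝 0) := by
    have : ContinuousAt (fun z : ℂ × ℂ => (z.1 - p₀, (0 : ℂ))) (p₀, 0) := by fun_prop
    rw [ContinuousAt, sub_self] at this
    exact this
  have t3 : Filter.Tendsto (fun z : ℂ × ℂ => z.1) (𝓝 (p₀, 0)) (𝓝 p₀) :=
    continuous_fst.tendsto' _ _ rfl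
  filter_upwards [t1 (Metric.eball_mem_nhds _ hR.r_pos), t2 (Metric.eball_mem_nhds _ hR.r_pos),
    t1 (Metric.eball_mem_nhds _ hrad), t3 h0] with z h1 h2 h3 h4
  have s1 := hR.hasSum h1
  have s2 := hR.hasSum h2
  have s3 := hq.hasSum h3
  have e1 : (p₀, (0 : ℂ)) + (z - (p₀, 0)) = z := by abel
  have e2 : (p₀, (0 : ℂ)) + (z.1 - p₀, (0 : ℂ)) = (z.1, 0) := by simp
  rw [e1] at s1
  rw [e2, show f (z.1, 0) = 0 from h4] at s2
  rw [zero_add] at s3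
  have s4 := s1.sub s2
  rw [sub_zero] at s4
  have s5 := s3.mul_left z.2
  have s6 : HasSum (fun n => P (n + 1) (fun _ => z - (p₀, 0)) -
      P (n + 1) (fun _ => (z.1 - p₀, (0 : ℂ)))) (z.2 * q.sum (z - (p₀, 0))) := by
    have e : (fun n => P (n + 1) (fun _ => z - (p₀, 0)) -
        P (n + 1) (fun _ => (z.1 - p₀, (0 : ℂ)))) = fun n => z.2 * q n fun _ => z - (p₀, 0) := by
      funext n
      have := hQ' n (z - (p₀, 0))
      simpa using this
    rw [e]
    exact s5
  have s7 := (hasSum_nat_add_iff' 1).2 s4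
  have hz : P 0 (fun _ => z - (p₀, 0)) - P 0 (fun _ => (z.1 - p₀, (0 : ℂ))) = 0 := by
    rw [sub_eq_zero]; congr 1; ext1 i; exact i.elim0
  rw [Finset.sum_range_one, hz, sub_zero] at s7
  exact s7.unique s6

/-! ### Covectors of the plane and uniqueness of the curvature -/

namespace PlaneWeb

theorem exists_prod_apply_ne_zero {α : Fin 3 → ℂ × ℂ}
    (h : ∀ i j, i ≠ j → wedge (α i) (α j) ≠ 0) : ∃ v, ∏ i, apply (α i) v ≠ 0 := by
  by_contra! hc
  have h01 := h 0 1 (by decide)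
  have h02 := h 0 2 (by decide)
  have h12 := h 1 2 (by decide)
  have key : ∀ s : ℂ, s ≠ 0 → wedge (α 0) (α 2) + s * wedge (α 1) (α 2) = 0 := fun s hs => by
    -- This vector spans the kernel of `α 0 + s α 1`. Neither `α 0` nor `α 1` vanishes on it, so `α
    -- 2` must; two values of `s` then make `α 1` and `α 2` dependent.
    have := hc (-(α 0).2 - s * (α 1).2, (α 0).1 + s * (α 1).1)
    rw [Fin.prod_univ_three] at this
    have e : s * wedge (α 0) (α 1) ^ 2 *
        (wedge (α 0) (α 2) + s * wedge (α 1) (α 2)) = 0 := by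
      simp only [apply, wedge] at this ⊢; linear_combination -this
    simpa [hs, h01] using e
  have k1 := key 1 one_ne_zero
  have k2 := key (-1) (by simp)
  refine h12 ?_
  linear_combination (k1 - k2) / 2

theorem wedge_smul_left (c : ℂ) (α β : ℂ × ℂ) : wedge (c • α) β = c * wedge α β := by
  simp only [wedge, Prod.smul_fst, Prod.smul_snd, smul_eq_mul]; ring

theorem wedge_smul_right (c : ℂ) (α β : ℂ × ℂ) : wedge α (c • β) = c * wedge α β := by
  simp only [wedge, Prod.smul_fst, Prod.smul_snd, smul_eq_mul]; ring

theorem apply_smul (c : ℂ) (α v : ℂ × ℂ) : apply (c • α) v = c * apply α v := by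
  simp only [apply, Prod.smul_fst, Prod.smul_snd, smul_eq_mul]; ring

theorem exists_eq_smul_of_wedge_eq_zero {α β : ℂ × ℂ} (hα : α ≠ 0) (h : wedge α β = 0) :
    ∃ c : ℂ, β = c • α := by
  obtain ⟨a, b⟩ := α
  obtain ⟨x, y⟩ := β
  simp only [wedge] at h
  by_cases ha : a = 0
  · have hb : b ≠ 0 := fun hb => hα (by simp [ha, hb])
    refine ⟨y / b, ?_⟩
    have hx : x = 0 := by simpa [ha, hb] using h
    simp [ha, hx, hb]
  · refine ⟨x / a, ?_⟩
    ext
    · simp [ha]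
    · simp only [Prod.smul_mk, smul_eq_mul]; field_simp; linear_combination h

theorem ne_zero_of_wedge_ne_zero {α β : ℂ × ℂ} (h : wedge α β ≠ 0) : α ≠ 0 := by
  rintro rfl; simp [wedge] at h

theorem extD_congr {ω ω' : ℂ × ℂ → ℂ × ℂ} {z : ℂ × ℂ} (h : ω =ᶠ[𝓝 z] ω') :
    extD ω z = extD ω' z := by
  have h1 : (fun y => (ω y).1) =ᶠ[𝓝 z] fun y => (ω' y).1 := h.fun_comp Prod.fst
  have h2 : (fun y => (ω y).2) =ᶠ[𝓝 z] fun y => (ω' y).2 := h.fun_comp Prod.snd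
  rw [extD, extD, h1.fderiv_eq, h2.fderiv_eq]

theorem extD_const_smul (c : ℂ) (ω : ℂ × ℂ → ℂ × ℂ) (z : ℂ × ℂ) :
    extD (fun t => c • ω t) z = c * extD ω z := by
  unfold extD
  have h1 : fderiv ℂ (fun y => (c • ω y).2) z = c • fderiv ℂ (fun y => (ω y).2) z :=
    congrFun (fderiv_const_smul_field (f := fun y => (ω y).2) c) z
  have h2 : fderiv ℂ (fun y => (c • ω y).1) z = c • fderiv ℂ (fun y => (ω y).1) z :=
    congrFun (fderiv_const_smul_field (f := fun y => (ω y).1) c) z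
  rw [h1, h2]
  simp; ring

/-- If two products of linear forms agree, each factor of the first is proportional to a factor of
the second. -/
theorem exists_wedge_eq_zero_of_prod_eq {α β : Fin 3 → ℂ × ℂ}
    (h : ∀ v, ∏ i, apply (α i) v = ∏ i, apply (β i) v) :
    ∀ i, ∃ j, wedge (α i) (β j) = 0 := fun i => by
  have h1 := h (-(α i).2, (α i).1)
  rw [Finset.prod_eq_zero (Finset.mem_univ i) (by simp only [apply]; ring)] at h1
  obtain ⟨j, -, hj⟩ := Finset.prod_eq_zero_iff.1 h1.symm
  exact ⟨j, by simp only [apply] at hj; simp only [wedge]; linear_combination hj⟩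

theorem wedge_ne_zero_of_wedge_eq_zero {α β γ : ℂ × ℂ} (hα : α ≠ 0) (h : wedge α β = 0)
    (hβγ : wedge β γ ≠ 0) : wedge α γ ≠ 0 := fun h' => by
  obtain ⟨c, rfl⟩ := exists_eq_smul_of_wedge_eq_zero hα h
  rw [wedge_smul_left, h', mul_zero] at hβγ
  exact hβγ rfl

/-- Reordering the factors affects the forms `δ_{jk} ω_i` only through the sign of the permutation:
the even ones commute with the cyclic shift, the odd ones reverse it. -/
theorem fin_three_cyclic_or_anticyclic (σ : Fin 3 → Fin 3) (h : Function.Injective σ) :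
    (∀ i, σ (i + 1) = σ i + 1 ∧ σ (i + 2) = σ i + 2) ∨
      ∀ i, σ (i + 1) = σ i + 2 ∧ σ (i + 2) = σ i + 1 := by
  revert σ; decide

theorem eq_of_wedge_eq {α β η θ : ℂ × ℂ} (h : wedge α β ≠ 0) (h1 : wedge α η = wedge α θ)
    (h2 : wedge β η = wedge β θ) : η = θ := by
  simp only [wedge] at *
  ext
  · refine mul_left_cancel₀ h ?_
    linear_combination β.1 * h1 - α.1 * h2
  · refine mul_left_cancel₀ h ?_
    linear_combination β.2 * h1 - α.2 * h2

/-- The curvature does not depend on the factorization of the web. -/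
theorem HasCurvatureAt.unique {W : ℂ × ℂ → ℂ × ℂ → ℂ} {z : ℂ × ℂ} {κ κ' : ℂ}
    (h : HasCurvatureAt W z κ) (h' : HasCurvatureAt W z κ') : κ = κ' := by
  obtain ⟨U, ω, η, hU, hzU, hω, -, hW, hind, hη, rfl⟩ := h
  obtain ⟨U', ω', η', hU', hzU', hω', -, hW', hind', hη', rfl⟩ := h'
  have hne : ∀ y ∈ U, ∀ i, ω i y ≠ 0 := fun y hy i =>
    ne_zero_of_wedge_ne_zero (hind y hy i (i + 1) (by revert i; decide))
  choose σ hσ using exists_wedge_eq_zero_of_prod_eq (fun v => (hW z hzU v).symm.trans (hW' z hzU' v))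
  have hσinj : Function.Injective σ := fun i k hik => by
    by_contra hne'
    obtain ⟨c, hc⟩ := exists_eq_smul_of_wedge_eq_zero (hne z hzU i) (hσ i)
    have h2 := hσ k
    rw [← hik, hc, wedge_smul_right] at h2
    rcases mul_eq_zero.1 h2 with h3 | h3
    · rw [h3, zero_smul] at hc
      exact ne_zero_of_wedge_ne_zero
        (hind' z hzU' (σ i) (σ i + 1) (by generalize σ i = j; revert j; decide)) hc
    · exact hind z hzU k i (Ne.symm hne') h3
  have hσbij : Function.Bijective σ := Finite.injective_iff_bijective.1 hσinj
  -- Factors not matched at `z` stay independent nearby, so the matching `σ` found at `z` is the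
  -- matching at all close points.
  have hfar : ∀ᶠ y in 𝓝 z, ∀ i j, j ≠ σ i → wedge (ω i y) (ω' j y) ≠ 0 := by
    refine Filter.eventually_all.2 fun i => Filter.eventually_all.2 fun j => ?_
    by_cases hj : j = σ i
    · simp [hj]
    · have hc : ContinuousAt (fun y => wedge (ω i y) (ω' j y)) z := by
        have c1 := (hω i z hzU).continuousAt
        have c2 := (hω' j z hzU').continuousAt
        unfold wedge
        fun_prop
      filter_upwards [hc.eventually_ne (wedge_ne_zero_of_wedge_eq_zero (hne z hzU i) (hσ i)
        (hind' z hzU' (σ i) j (Ne.symm hj)))] with y hy _ using hy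
  -- The proportionality factors have product 1, so `δ_{jk} ω_i` changes only by the sign `s` of
  -- `σ`. A constant cancels from the equations defining `η`.
  obtain ⟨s, hs⟩ : ∃ s : ℂ, ∀ᶠ y in 𝓝 z, ∀ i,
      wedge (ω (i + 1) y) (ω (i + 2) y) • ω i y =
        s • wedge (ω' (σ i + 1) y) (ω' (σ i + 2) y) • ω' (σ i) y := by
    have hev : ∀ᶠ y in 𝓝 z, ∃ f : Fin 3 → ℂ, f 0 * f 1 * f 2 = 1 ∧ ∀ i, ω' (σ i) y = f i • ω i y := by
      filter_upwards [hfar, hU.mem_nhds hzU, hU'.mem_nhds hzU'] with y hy hyU hyU'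
      have hpar : ∀ i, wedge (ω i y) (ω' (σ i) y) = 0 := fun i => by
        obtain ⟨j, hj⟩ := exists_wedge_eq_zero_of_prod_eq
          (fun v => (hW y hyU v).symm.trans (hW' y hyU' v)) i
        by_cases hji : j = σ i
        · rwa [← hji]
        · exact absurd hj (hy i j hji)
      choose f hf using fun i => exists_eq_smul_of_wedge_eq_zero (hne y hyU i) (hpar i)
      refine ⟨f, ?_, hf⟩
      obtain ⟨v, hv⟩ := exists_prod_apply_ne_zero (hind y hyU)
      have e1 := (hW y hyU v).symm.trans (hW' y hyU' v)
      rw [← hσbij.prod_comp (fun j => apply (ω' j y) v)] at e1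
      simp only [hf, apply_smul, Finset.prod_mul_distrib] at e1
      rw [Fin.prod_univ_three f] at e1
      exact mul_right_cancel₀ hv (by rw [one_mul]; exact e1.symm)
    rcases fin_three_cyclic_or_anticyclic σ hσinj with hc | hc
    · refine ⟨1, ?_⟩
      filter_upwards [hev] with y ⟨f, hf1, hf⟩ i
      rw [← (hc i).1, ← (hc i).2, hf, hf, hf, wedge_smul_left, wedge_smul_right, one_smul, smul_smul]
      congr 1
      have : f (i + 1) * f (i + 2) * f i = 1 := by
        rw [← hf1]; fin_cases i <;> simp <;> ring
      linear_combination (-wedge (ω (i + 1) y) (ω (i + 2) y)) * this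
    · refine ⟨-1, ?_⟩
      filter_upwards [hev] with y ⟨f, hf1, hf⟩ i
      rw [← (hc i).1, ← (hc i).2, hf, hf, hf, wedge_smul_left, wedge_smul_right, smul_smul, smul_smul]
      congr 1
      have : f (i + 1) * f (i + 2) * f i = 1 := by
        rw [← hf1]; fin_cases i <;> simp <;> ring
      have hanti : wedge (ω (i + 2) y) (ω (i + 1) y) = - wedge (ω (i + 1) y) (ω (i + 2) y) := by
        simp only [wedge]; ring
      rw [hanti]
      linear_combination (-wedge (ω (i + 1) y) (ω (i + 2) y)) * this
  refine extD_congr ?_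
  filter_upwards [hs.eventually_nhds, hU.mem_nhds hzU, hU'.mem_nhds hzU'] with y hy hyU hyU'
  have heq : ∀ i, wedge (wedge (ω (i + 1) y) (ω (i + 2) y) • ω i y) (η y) =
      wedge (wedge (ω (i + 1) y) (ω (i + 2) y) • ω i y) (η' y) := fun i => by
    rw [← hη y hyU i, extD_congr (hy.mono fun t ht => ht i), extD_const_smul, hη' y hyU' (σ i),
      hy.self_of_nhds i, wedge_smul_left s]
  refine eq_of_wedge_eq ?_ (heq 0) (heq 1)
  rw [wedge_smul_left, wedge_smul_right]
  refine mul_ne_zero ?_ (mul_ne_zero ?_ ?_) <;> exact hind y hyU _ _ (by decide)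

/-- Absorbing `c` in `ω 0` multiplies every `δ_{jk} ω_i` by `c`, so the same `η` works. -/
theorem HasCurvatureAt.const_mul {W : ℂ × ℂ → ℂ × ℂ → ℂ} {z : ℂ × ℂ} {κ c : ℂ} (hc : c ≠ 0)
    (h : HasCurvatureAt W z κ) : HasCurvatureAt (fun y v => c * W y v) z κ := by
  obtain ⟨U, ω, η, hU, hzU, hω, hηU, hW, hind, hη, hκ⟩ := h
  let s : Fin 3 → ℂ := ![c, 1, 1]
  have hs : ∀ i, s i ≠ 0 := by intro i; fin_cases i <;> simp [s, hc]
  have hs1 : ∀ i, s (i + 1) * s (i + 2) * s i = c := by intro i; fin_cases i <;> simp [s]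
  refine ⟨U, fun i y => s i • ω i y, η, hU, hzU, fun i y hy => analyticAt_const.fun_smul (hω i y hy), hηU, ?_, ?_, ?_, hκ⟩
  · intro y hy v
    simp only [apply_smul, Finset.prod_mul_distrib]
    rw [hW y hy v, Fin.prod_univ_three s]
    simp [s]
  · intro y hy i j hij
    rw [wedge_smul_left, wedge_smul_right]
    exact mul_ne_zero (hs i) (mul_ne_zero (hs j) (hind y hy i j hij))
  · intro y hy i
    have e : ∀ t, wedge (s (i + 1) • ω (i + 1) t) (s (i + 2) • ω (i + 2) t) • s i • ω i t =
        c • wedge (ω (i + 1) t) (ω (i + 2) t) • ω i t := fun t => by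
      rw [wedge_smul_left, wedge_smul_right, smul_smul, smul_smul]
      congr 1
      linear_combination wedge (ω (i + 1) t) (ω (i + 2) t) * hs1 i
    simp only [e]
    rw [extD_const_smul, hη y hy i, wedge_smul_left c]

theorem HasCurvatureAt.notMem_discriminant {W : ℂ × ℂ → ℂ × ℂ → ℂ} {z : ℂ × ℂ} {κ : ℂ}
    (h : HasCurvatureAt W z κ) : z ∉ discriminant 3 W := by
  obtain ⟨U, ω, η, hU, hzU, -, -, hW, hind, -⟩ := h
  exact fun hd => hd ⟨fun i => ω i z, hW z hzU, hind z hzU⟩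

/-- A point at which a `3`-web is the cube of a linear form lies in the discriminant. -/
theorem mem_discriminant_of_cube {W : ℂ × ℂ → ℂ × ℂ → ℂ} {z : ℂ × ℂ} {k : ℂ}
    (h : ∀ v, W z v = k * v.2 ^ 3) : z ∈ discriminant 3 W := by
  rintro ⟨α, hα, hind⟩
  have h1 : ∀ i, k * (α i).1 ^ 3 = 0 := fun i => by
    have := (h (-(α i).2, (α i).1)).symm.trans (hα _)
    rw [Finset.prod_eq_zero (Finset.mem_univ i) (by simp only [apply]; ring)] at this
    exact this
  obtain ⟨v, hv⟩ := exists_prod_apply_ne_zero hind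
  have hk : k ≠ 0 := by
    rintro rfl
    exact hv (by rw [← hα v, h v, zero_mul])
  have h2 : ∀ i, (α i).1 = 0 := fun i => by simpa [hk] using h1 i
  exact hind 0 1 (by decide) (by simp [wedge, h2])

/-! ### Analytic factorization of binary cubic forms -/

section Analytic

variable {E : Type*} [NormedAddCommGroup E] [NormedSpace ℂ E] {x : E}

theorem analyticAt_wedge {α β : E → ℂ × ℂ} (hα : AnalyticAt ℂ α x) (hβ : AnalyticAt ℂ β x) :
    AnalyticAt ℂ (fun t => wedge (α t) (β t)) x := by
  have x1 : AnalyticAt ℂ (fun t => (α t).1) x := analyticAt_fst.fun_comp hα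
  have x2 : AnalyticAt ℂ (fun t => (α t).2) x := analyticAt_snd.fun_comp hα
  have y1 : AnalyticAt ℂ (fun t => (β t).1) x := analyticAt_fst.fun_comp hβ
  have y2 : AnalyticAt ℂ (fun t => (β t).2) x := analyticAt_snd.fun_comp hβ
  exact (x1.mul y2).sub (x2.mul y1)

theorem analyticAt_fderiv_apply {f : E → ℂ} (hf : AnalyticAt ℂ f x) (v : E) :
    AnalyticAt ℂ (fun t => fderiv ℂ f t v) x :=
  ((ContinuousLinearMap.apply ℂ ℂ v).analyticAt _).fun_comp hf.fderiv

end Analytic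

/-- The binary cubic form with given coefficients. -/
def binaryCubic (c : Fin 4 → ℂ) (v : ℂ × ℂ) : ℂ :=
  c 0 * v.1 ^ 3 + c 1 * v.1 ^ 2 * v.2 + c 2 * v.1 * v.2 ^ 2 + c 3 * v.2 ^ 3

theorem analyticAt_binaryCubic {E : Type*} [NormedAddCommGroup E] [NormedSpace ℂ E]
    {c : E → Fin 4 → ℂ} {v : E → ℂ × ℂ} {x : E} (hc : AnalyticAt ℂ c x) (hv : AnalyticAt ℂ v x) :
    AnalyticAt ℂ (fun t => binaryCubic (c t) (v t)) x := by
  have h : ∀ i, AnalyticAt ℂ (fun t => c t i) x := fun i => analyticAt_pi_iff.1 hc i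
  have h0 := h 0
  have h1 := h 1
  have h2 := h 2
  have h3 := h 3
  have v1 : AnalyticAt ℂ (fun t => (v t).1) x := analyticAt_fst.fun_comp hv
  have v2 : AnalyticAt ℂ (fun t => (v t).2) x := analyticAt_snd.fun_comp hv
  unfold binaryCubic
  fun_prop

/-- A binary cubic form is determined up to a factor by three distinct roots. -/
theorem binaryCubic_mul_prod_wedge {c : Fin 4 → ℂ} {e : Fin 3 → ℂ × ℂ}
    (h : ∀ i, binaryCubic c (e i) = 0) (hind : ∀ i j, i ≠ j → wedge (e i) (e j) ≠ 0)
    (v w : ℂ × ℂ) :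
    binaryCubic c v * ∏ i, wedge (e i) w = binaryCubic c w * ∏ i, wedge (e i) v := by
  obtain ⟨P, Q, hPQ⟩ : ∃ P Q : ℂ, ∀ x y : ℂ,
      binaryCubic c (x • e 0 + y • e 1) = x * y * (P * x + Q * y) := by
    have h0 := h 0
    have h1 := h 1
    set a := e 0
    set b := e 1
    refine ⟨3 * c 0 * a.1 ^ 2 * b.1 + c 1 * (a.1 ^ 2 * b.2 + 2 * a.1 * b.1 * a.2) +
        c 2 * (b.1 * a.2 ^ 2 + 2 * a.1 * a.2 * b.2) + 3 * c 3 * a.2 ^ 2 * b.2,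
      3 * c 0 * b.1 ^ 2 * a.1 + c 1 * (b.1 ^ 2 * a.2 + 2 * b.1 * a.1 * b.2) +
        c 2 * (a.1 * b.2 ^ 2 + 2 * b.1 * b.2 * a.2) + 3 * c 3 * b.2 ^ 2 * a.2, fun x y => ?_⟩
    simp only [binaryCubic, Prod.fst_add, Prod.snd_add, Prod.smul_fst, Prod.smul_snd,
      smul_eq_mul] at h0 h1 ⊢
    linear_combination x ^ 3 * h0 + y ^ 3 * h1
  have h01 := hind 0 1 (by decide)
  have h02 := hind 0 2 (by decide)
  have h12 := hind 1 2 (by decide)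
  -- Cramer's rule: `wedge (e 0) (e 1) • u = wedge u (e 1) • e 0 + wedge (e 0) u • e 1`.
  have hexp : ∀ u, wedge (e 0) (e 1) ^ 3 * binaryCubic c u =
      wedge u (e 1) * wedge (e 0) u * (P * wedge u (e 1) + Q * wedge (e 0) u) := fun u => by
    rw [← hPQ]
    simp only [binaryCubic, Prod.fst_add, Prod.snd_add, Prod.smul_fst, Prod.smul_snd,
      smul_eq_mul, wedge]
    ring
  have h2 := hexp (e 2)
  rw [h 2, mul_zero] at h2
  have h21 : wedge (e 2) (e 1) ≠ 0 := hind 2 1 (by decide)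
  have h2' : P * wedge (e 2) (e 1) + Q * wedge (e 0) (e 2) = 0 := by
    simpa [h21, h02] using h2.symm
  -- The remaining linear factor vanishes at `e 2`, hence is a multiple of `wedge u (e 2)`.
  have hP : ∀ u, wedge (e 0) (e 2) * (P * wedge u (e 1) + Q * wedge (e 0) u) =
      P * wedge (e 0) (e 1) * wedge u (e 2) := fun u => by
    simp only [wedge] at h2' ⊢
    linear_combination (e 0).1 * u.2 * h2' - (e 0).2 * u.1 * h2'
  have hfin : ∀ u, wedge (e 0) (e 2) * wedge (e 0) (e 1) ^ 3 * binaryCubic c u =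
      P * wedge (e 0) (e 1) * ∏ i, wedge (e i) u := fun u => by
    rw [mul_assoc, hexp, Fin.prod_univ_three]
    have e1 : wedge u (e 1) = - wedge (e 1) u := by simp only [wedge]; ring
    have e2 : wedge u (e 2) = - wedge (e 2) u := by simp only [wedge]; ring
    have := hP u
    rw [e2] at this
    rw [e1] at this ⊢
    linear_combination (- wedge (e 1) u * wedge (e 0) u) * this
  have hne : wedge (e 0) (e 2) * wedge (e 0) (e 1) ^ 3 ≠ 0 := mul_ne_zero h02 (pow_ne_zero _ h01)
  refine mul_left_cancel₀ hne ?_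
  linear_combination (∏ i, wedge (e i) w) * hfin v - (∏ i, wedge (e i) v) * hfin w

/-- A simple root of a binary cubic form depends analytically on the coefficients. -/
theorem exists_analyticAt_root {c₀ : Fin 4 → ℂ} {e f : ℂ × ℂ} {d : ℂ} (h : binaryCubic c₀ e = 0)
    (hd : HasDerivAt (fun r : ℂ => binaryCubic c₀ (e + r • f)) d 0) (hd0 : d ≠ 0) :
    ∃ ρ : (Fin 4 → ℂ) → ℂ, AnalyticAt ℂ ρ c₀ ∧ ρ c₀ = 0 ∧
      ∀ᶠ c in 𝓝 c₀, binaryCubic c (e + ρ c • f) = 0 := by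
  let g : (Fin 4 → ℂ) × ℂ → ℂ := fun t => binaryCubic t.1 (e + t.2 • f)
  have hg : AnalyticAt ℂ g (c₀, 0) :=
    analyticAt_binaryCubic analyticAt_fst (analyticAt_const.add (analyticAt_snd.smul analyticAt_const))
  have hg' : ContDiffAt ℂ ⊤ g (c₀, 0) := hg.contDiffAt
  -- Hypothesis of the implicit function theorem: the partial derivative in `r` is multiplication by
  -- `d ≠ 0`.
  have hinv : (fderiv ℂ g (c₀, 0) ∘L .inr ℂ (Fin 4 → ℂ) ℂ).IsInvertible := by
    have h1 : HasDerivAt (fun r : ℂ => g (c₀, r)) (fderiv ℂ g (c₀, 0) (0, 1)) 0 := by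
      have h2 : HasDerivAt (fun r : ℂ => (c₀, r)) (0, 1) 0 :=
        (hasDerivAt_const (0 : ℂ) c₀).prodMk (hasDerivAt_id 0)
      exact hg.differentiableAt.hasFDerivAt.comp_hasDerivAt (0 : ℂ) h2
    have h3 : fderiv ℂ g (c₀, 0) (0, 1) = d := h1.unique hd
    refine ⟨ContinuousLinearEquiv.unitsEquivAut ℂ (Units.mk0 d hd0), ?_⟩
    ext
    simp [h3]
  refine ⟨hg'.implicitFunction (by simp) hinv, ?_, ?_, ?_⟩
  · exact (hg'.contDiffAt_implicitFunction (by simp) hinv).analyticAt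
  · exact hg'.implicitFunction_apply_self (by simp) hinv
  · have := hg'.eventually_apply_implicitFunction (by simp) hinv
    filter_upwards [this] with c hc
    have hg0 : g (c₀, 0) = 0 := by simpa [g] using h
    rw [hg0] at hc
    exact hc

/-- A binary cubic form without multiple roots factors into linear forms, analytically in the
coefficients. -/
theorem exists_analyticAt_factorization {c₀ : Fin 4 → ℂ} {α : Fin 3 → ℂ × ℂ}
    (hα : ∀ v, binaryCubic c₀ v = ∏ i, apply (α i) v)
    (hind : ∀ i j, i ≠ j → wedge (α i) (α j) ≠ 0) :
    ∃ a : Fin 3 → (Fin 4 → ℂ) → ℂ × ℂ, (∀ i, AnalyticAt ℂ (a i) c₀) ∧ ∀ᶠ c in 𝓝 c₀,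
      (∀ v, binaryCubic c v = ∏ i, apply (a i c) v) ∧
        ∀ i j, i ≠ j → wedge (a i c) (a j c) ≠ 0 := by
  let e : Fin 3 → ℂ × ℂ := fun i => (-(α i).2, (α i).1)
  have he : ∀ i j, wedge (e i) (e j) = wedge (α i) (α j) := fun i j => by
    simp only [e, wedge]; ring
  have hev : ∀ i v, apply (α i) v = - wedge (e i) v := fun i v => by
    simp only [e, wedge, apply]; ring
  have hroot : ∀ i, binaryCubic c₀ (e i) = 0 := fun i => by
    rw [hα, Finset.prod_eq_zero (Finset.mem_univ i)]
    simp only [e, apply]; ring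
  have hind3 : ∀ i : Fin 3, i ≠ i + 1 ∧ i + 1 ≠ i ∧ i + 2 ≠ i ∧ i + 2 ≠ i + 1 := by decide
  -- Each root moves in the direction of the next one, which is transverse to it.
  have hexr : ∀ i : Fin 3, ∃ ρ : (Fin 4 → ℂ) → ℂ, AnalyticAt ℂ ρ c₀ ∧ ρ c₀ = 0 ∧
      ∀ᶠ c in 𝓝 c₀, binaryCubic c (e i + ρ c • e (i + 1)) = 0 := fun i => by
    have hprod : ∀ v, binaryCubic c₀ v =
        - (wedge (e i) v * wedge (e (i + 1)) v * wedge (e (i + 2)) v) := fun v => by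
      rw [hα, Fin.prod_univ_three, hev, hev, hev]
      fin_cases i <;> simp <;> ring
    have hfun : (fun r : ℂ => binaryCubic c₀ (e i + r • e (i + 1))) = fun r =>
        r * (-(wedge (e i) (e (i + 1)) * wedge (e (i + 1)) (e i) *
          (wedge (e (i + 2)) (e i) + r * wedge (e (i + 2)) (e (i + 1))))) := by
      funext r
      rw [hprod]
      simp only [wedge, Prod.fst_add, Prod.snd_add, Prod.smul_fst, Prod.smul_snd, smul_eq_mul]
      ring
    refine exists_analyticAt_root (d := -(wedge (e i) (e (i + 1)) * wedge (e (i + 1)) (e i) *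
      wedge (e (i + 2)) (e i))) (hroot i) ?_ ?_
    · rw [hfun]
      have h1 : HasDerivAt (fun r : ℂ => wedge (e (i + 2)) (e i) +
          r * wedge (e (i + 2)) (e (i + 1))) (1 * wedge (e (i + 2)) (e (i + 1))) 0 :=
        ((hasDerivAt_id (0 : ℂ)).mul_const _).const_add _
      refine ((hasDerivAt_id' (0 : ℂ)).fun_mul
        (h1.const_mul (wedge (e i) (e (i + 1)) * wedge (e (i + 1)) (e i))).fun_neg).congr_deriv ?_
      simp
    · simp only [he, ne_eq, neg_eq_zero, mul_eq_zero, not_or]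
      obtain ⟨k1, k2, k3, -⟩ := hind3 i
      exact ⟨⟨hind _ _ k1, hind _ _ k2⟩, hind _ _ k3⟩
  choose ρ hρ hρ0 hρr using hexr
  let ε : Fin 3 → (Fin 4 → ℂ) → ℂ × ℂ := fun i c => e i + ρ i c • e (i + 1)
  have hε : ∀ i, AnalyticAt ℂ (ε i) c₀ := fun i =>
    analyticAt_const.add ((hρ i).smul analyticAt_const)
  have hε0 : ∀ i, ε i c₀ = e i := fun i => by simp [ε, hρ0]
  obtain ⟨w, hw⟩ := exists_prod_apply_ne_zero hind
  have hcw : binaryCubic c₀ w ≠ 0 := by rwa [hα]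
  have hew : ∀ i, wedge (ε i c₀) w ≠ 0 := fun i h => by
    refine hw (Finset.prod_eq_zero (Finset.mem_univ i) ?_)
    rw [hev, ← hε0, h, neg_zero]
  -- The roots fix the form up to a scalar; comparing values at `w`, where the form is nonzero,
  -- gives it.
  let k : (Fin 4 → ℂ) → ℂ := fun c => binaryCubic c w * (wedge (ε 0 c) w * wedge (ε 1 c) w *
    wedge (ε 2 c) w)⁻¹
  have hk : AnalyticAt ℂ k c₀ := by
    refine (analyticAt_binaryCubic analyticAt_id analyticAt_const).mul (AnalyticAt.inv ?_ ?_)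
    · exact ((analyticAt_wedge (hε 0) analyticAt_const).mul (analyticAt_wedge (hε 1) analyticAt_const)).mul
        (analyticAt_wedge (hε 2) analyticAt_const)
    · exact mul_ne_zero (mul_ne_zero (hew 0) (hew 1)) (hew 2)
  have hk0 : k c₀ ≠ 0 := mul_ne_zero hcw
    (inv_ne_zero (mul_ne_zero (mul_ne_zero (hew 0) (hew 1)) (hew 2)))
  let s : Fin 3 → (Fin 4 → ℂ) → ℂ := ![k, fun _ => 1, fun _ => 1]
  have hs : ∀ i, AnalyticAt ℂ (s i) c₀ := fun i => by
    fin_cases i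
    · exact hk
    · exact analyticAt_const
    · exact analyticAt_const
  refine ⟨fun i c => s i c • (-(ε i c).2, (ε i c).1), fun i => (hs i).fun_smul
    ((analyticAt_snd.fun_comp (hε i)).neg.prod (analyticAt_fst.fun_comp (hε i))), ?_⟩
  have hnear : ∀ᶠ c in 𝓝 c₀, ∀ i j, i ≠ j → wedge (ε i c) (ε j c) ≠ 0 := by
    refine Filter.eventually_all.2 fun i => Filter.eventually_all.2 fun j => ?_
    by_cases hij : i = j
    · simp [hij]
    · filter_upwards [(analyticAt_wedge (hε i) (hε j)).continuousAt.eventually_ne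
        (by rw [hε0, hε0, he]; exact hind i j hij)] with c hc _ using hc
  have hnearw : ∀ᶠ c in 𝓝 c₀, ∀ i, wedge (ε i c) w ≠ 0 := Filter.eventually_all.2 fun i =>
    (analyticAt_wedge (hε i) analyticAt_const).continuousAt.eventually_ne (hew i)
  filter_upwards [hnear, hnearw, hk.continuousAt.eventually_ne hk0,
    Filter.eventually_all.2 hρr] with c h1 h2 h3 h4
  have hsne : ∀ i, s i c ≠ 0 := fun i => by fin_cases i <;> simp [s, h3]
  constructor
  · intro v
    have := binaryCubic_mul_prod_wedge (e := fun i => ε i c) h4 h1 v w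
    rw [Fin.prod_univ_three, Fin.prod_univ_three] at this
    simp only [apply_smul, Finset.prod_mul_distrib]
    rw [Fin.prod_univ_three, Fin.prod_univ_three]
    have hw3 := mul_ne_zero (mul_ne_zero (h2 0) (h2 1)) (h2 2)
    have hav : ∀ i, apply (-(ε i c).2, (ε i c).1) v = wedge (ε i c) v := fun i => by
      simp only [apply, wedge]; ring
    rw [hav, hav, hav, eq_comm]
    refine mul_right_cancel₀ hw3 ?_
    rw [this]
    have hkc : k c * (wedge (ε 0 c) w * wedge (ε 1 c) w * wedge (ε 2 c) w) = binaryCubic c w := by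
      simp only [k]; rw [mul_assoc, inv_mul_cancel₀ hw3, mul_one]
    simp only [s, Matrix.cons_val_zero, Matrix.cons_val_one, Matrix.cons_val_two,
      Matrix.head_cons, Matrix.tail_cons]
    linear_combination (wedge (ε 0 c) v * wedge (ε 1 c) v * wedge (ε 2 c) v) * hkc
  · intro i j hij
    rw [wedge_smul_left, wedge_smul_right]
    refine mul_ne_zero (hsne i) (mul_ne_zero (hsne j) ?_)
    have := h1 i j hij
    simp only [wedge] at this ⊢
    intro h; exact this (by linear_combination h)

/-! Webs with logarithmic form `∏ (a_i dp + b_i dq / q)`, up to the factor `q ^ 3`. -/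

/-- `δ_{jk} • a_i` for the cyclic permutations `(i, j, k)`. -/
noncomputable def normalForm (a : Fin 3 → ℂ × ℂ → ℂ × ℂ) (i : Fin 3) (z : ℂ × ℂ) : ℂ × ℂ :=
  wedge (a (i + 1) z) (a (i + 2) z) • a i z

/-- The function `E` with `d(q² θ₁ dp + q θ₂ dq) = q E dp ∧ dq`. -/
noncomputable def logExtD (θ : ℂ × ℂ → ℂ × ℂ) (z : ℂ × ℂ) : ℂ :=
  fderiv ℂ (fun y => (θ y).2) z (1, 0) - 2 * (θ z).1 - z.2 * fderiv ℂ (fun y => (θ y).1) z (0, 1)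

/-- The coefficients of the form `η = α dp + β dq / q` of a logarithmic web. -/
noncomputable def logConnection (a : Fin 3 → ℂ × ℂ → ℂ × ℂ) (z : ℂ × ℂ) : ℂ × ℂ :=
  (wedge (a 0 z) (a 1 z))⁻¹ •
    ((logExtD (normalForm a 0) z * (wedge (a 1 z) (a 2 z))⁻¹) • a 1 z -
      (logExtD (normalForm a 1) z * (wedge (a 2 z) (a 0 z))⁻¹) • a 0 z)

/-- The coefficient of the curvature of a logarithmic web. -/
noncomputable def logCurvature (a : Fin 3 → ℂ × ℂ → ℂ × ℂ) (z : ℂ × ℂ) : ℂ :=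
  fderiv ℂ (fun y => (logConnection a y).2) z (1, 0) / z.2 -
    fderiv ℂ (fun y => (logConnection a y).1) z (0, 1)

variable {a a' : Fin 3 → ℂ × ℂ → ℂ × ℂ} {z : ℂ × ℂ}

theorem analyticAt_normalForm (ha : ∀ i, AnalyticAt ℂ (a i) z) (i : Fin 3) :
    AnalyticAt ℂ (normalForm a i) z :=
  (analyticAt_wedge (ha _) (ha _)).smul (ha i)

theorem analyticAt_logExtD {θ : ℂ × ℂ → ℂ × ℂ} (hθ : AnalyticAt ℂ θ z) :
    AnalyticAt ℂ (logExtD θ) z := by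
  have h1 : AnalyticAt ℂ (fun t => (θ t).1) z := analyticAt_fst.fun_comp hθ
  have h2 : AnalyticAt ℂ (fun t => (θ t).2) z := analyticAt_snd.fun_comp hθ
  exact ((analyticAt_fderiv_apply h2 _).sub (analyticAt_const.mul h1)).sub
    (analyticAt_snd.mul (analyticAt_fderiv_apply h1 _))

theorem analyticAt_logConnection (ha : ∀ i, AnalyticAt ℂ (a i) z)
    (hind : ∀ i j, i ≠ j → wedge (a i z) (a j z) ≠ 0) : AnalyticAt ℂ (logConnection a) z :=
  ((analyticAt_wedge (ha _) (ha _)).inv (hind 0 1 (by decide))).smul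
    ((((analyticAt_logExtD (analyticAt_normalForm ha 0)).mul
      ((analyticAt_wedge (ha _) (ha _)).inv (hind 1 2 (by decide)))).smul (ha 1)).sub
    (((analyticAt_logExtD (analyticAt_normalForm ha 1)).mul
      ((analyticAt_wedge (ha _) (ha _)).inv (hind 2 0 (by decide)))).smul (ha 0)))

/-- This is `δ₁₂ ω₀ + δ₂₀ ω₁ + δ₀₁ ω₂ = 0`; it makes the third equation for `η` follow from the
other two. -/
theorem normalForm_add (a : Fin 3 → ℂ × ℂ → ℂ × ℂ) :
    normalForm a 2 = fun z => -(normalForm a 0 z + normalForm a 1 z) := by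
  funext z
  have e1 : (2 : Fin 3) + 1 = 0 := rfl
  have e2 : (2 : Fin 3) + 2 = 1 := rfl
  have e3 : (1 : Fin 3) + 2 = 0 := rfl
  have e4 : (1 : Fin 3) + 1 = 2 := rfl
  ext <;>
  · simp only [normalForm, wedge, e1, e2, e3, e4, zero_add, Prod.fst_neg, Prod.snd_neg,
      Prod.fst_add, Prod.snd_add, Prod.smul_fst, Prod.smul_snd, smul_eq_mul]
    ring

theorem logExtD_neg_add {θ θ' : ℂ × ℂ → ℂ × ℂ} (h : AnalyticAt ℂ θ z) (h' : AnalyticAt ℂ θ' z) :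
    logExtD (fun y => -(θ y + θ' y)) z = -(logExtD θ z + logExtD θ' z) := by
  have h1 : DifferentiableAt ℂ (fun t => (θ t).1) z := h.differentiableAt.fst
  have h2 : DifferentiableAt ℂ (fun t => (θ t).2) z := h.differentiableAt.snd
  have h1' : DifferentiableAt ℂ (fun t => (θ' t).1) z := h'.differentiableAt.fst
  have h2' : DifferentiableAt ℂ (fun t => (θ' t).2) z := h'.differentiableAt.snd
  simp only [logExtD, Prod.fst_neg, Prod.snd_neg, Prod.fst_add, Prod.snd_add]
  rw [fderiv_fun_neg, fderiv_fun_neg, fderiv_fun_add h1 h1', fderiv_fun_add h2 h2']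
  simp only [neg_apply, add_apply]
  ring

/-- `logConnection` is Cramer's solution of the equations for `i = 0, 1`; `normalForm_add` gives `i
= 2`. -/
theorem wedge_normalForm_logConnection (ha : ∀ i, AnalyticAt ℂ (a i) z)
    (hind : ∀ i j, i ≠ j → wedge (a i z) (a j z) ≠ 0) (i : Fin 3) :
    wedge (normalForm a i z) (logConnection a z) = logExtD (normalForm a i) z := by
  have h01 := hind 0 1 (by decide)
  have h12 := hind 1 2 (by decide)
  have h20 := hind 2 0 (by decide)
  have e0 : wedge (normalForm a 0 z) (logConnection a z) = logExtD (normalForm a 0) z := by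
    have : wedge (normalForm a 0 z) (logConnection a z) =
        (wedge (a 1 z) (a 2 z) * (wedge (a 1 z) (a 2 z))⁻¹) *
        (wedge (a 0 z) (a 1 z) * (wedge (a 0 z) (a 1 z))⁻¹) * logExtD (normalForm a 0) z := by
      generalize hE : logExtD (normalForm a 0) z = E0
      simp only [logConnection, hE, normalForm, wedge_smul_left, wedge_smul_right, zero_add]
      generalize (wedge (a 0 z) (a 1 z))⁻¹ = x
      generalize (wedge (a 1 z) (a 2 z))⁻¹ = y
      simp only [wedge, Prod.fst_sub, Prod.snd_sub, Prod.smul_fst, Prod.smul_snd, smul_eq_mul]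
      ring
    rw [this, mul_inv_cancel₀ h01, mul_inv_cancel₀ h12, one_mul, one_mul]
  have e1 : wedge (normalForm a 1 z) (logConnection a z) = logExtD (normalForm a 1) z := by
    have : wedge (normalForm a 1 z) (logConnection a z) =
        (wedge (a 2 z) (a 0 z) * (wedge (a 2 z) (a 0 z))⁻¹) *
        (wedge (a 0 z) (a 1 z) * (wedge (a 0 z) (a 1 z))⁻¹) * logExtD (normalForm a 1) z := by
      generalize hE : logExtD (normalForm a 1) z = E0
      have e3 : (1 : Fin 3) + 2 = 0 := rfl
      have e4 : (1 : Fin 3) + 1 = 2 := rfl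
      simp only [logConnection, hE, normalForm, wedge_smul_left, wedge_smul_right, e3, e4]
      generalize (wedge (a 0 z) (a 1 z))⁻¹ = x
      generalize (wedge (a 2 z) (a 0 z))⁻¹ = y
      simp only [wedge, Prod.fst_sub, Prod.snd_sub, Prod.smul_fst, Prod.smul_snd, smul_eq_mul]
      ring
    rw [this, mul_inv_cancel₀ h01, mul_inv_cancel₀ h20, one_mul, one_mul]
  fin_cases i
  · exact e0
  · exact e1
  · change wedge (normalForm a 2 z) _ = logExtD (normalForm a 2) z
    rw [normalForm_add, logExtD_neg_add (analyticAt_normalForm ha 0) (analyticAt_normalForm ha 1),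
      ← e0, ← e1]
    simp only [wedge, Prod.fst_neg, Prod.snd_neg, Prod.fst_add, Prod.snd_add]
    ring

theorem extD_log {θ : ℂ × ℂ → ℂ × ℂ} (h : AnalyticAt ℂ θ z) :
    extD (fun y => (y.2 ^ 2 * (θ y).1, y.2 * (θ y).2)) z = z.2 * logExtD θ z := by
  have h1 : HasFDerivAt (fun t => (θ t).1) (fderiv ℂ (fun t => (θ t).1) z) z :=
    h.differentiableAt.fst.hasFDerivAt
  have h2 : HasFDerivAt (fun t => (θ t).2) (fderiv ℂ (fun t => (θ t).2) z) z :=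
    h.differentiableAt.snd.hasFDerivAt
  have hq : HasFDerivAt (fun y : ℂ × ℂ => y.2) (ContinuousLinearMap.snd ℂ ℂ ℂ) z := hasFDerivAt_snd
  simp only [extD, logExtD, pow_two]
  have h3 := (hq.fun_mul hq).fun_mul h1
  rw [h3.fderiv, (hq.fun_mul h2).fderiv]
  simp
  ring

/-- For `ω_i = q (a_i dp + b_i dq/q)` both sides of the equations for `η = α dp + β dq/q` carry the
same factor `q`; cancelling it leaves the equations solved by `logConnection`. -/
theorem hasCurvatureAt_logCurvature {W : ℂ × ℂ → ℂ × ℂ → ℂ} (hz : z.2 ≠ 0)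
    (h : ∀ᶠ y in 𝓝 z, (∀ i, AnalyticAt ℂ (a i) y) ∧
      (∀ i j, i ≠ j → wedge (a i y) (a j y) ≠ 0) ∧
      ∀ v, W y v = ∏ i, apply (y.2 * (a i y).1, (a i y).2) v) :
    HasCurvatureAt W z (logCurvature a z) := by
  have hq : ∀ᶠ y : ℂ × ℂ in 𝓝 z, y.2 ≠ 0 := continuous_snd.continuousAt.eventually_ne hz
  obtain ⟨U, hUs, hU, hzU⟩ := mem_nhds_iff.1 (h.and hq)
  have hw : ∀ (y : ℂ × ℂ) (i j : Fin 3),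
      wedge (y.2 * (a i y).1, (a i y).2) (y.2 * (a j y).1, (a j y).2) =
        y.2 * wedge (a i y) (a j y) := fun y i j => by
    simp only [wedge]; ring
  refine ⟨U, fun i y => (y.2 * (a i y).1, (a i y).2),
    fun y => ((logConnection a y).1, (logConnection a y).2 / y.2), hU, hzU, ?_, ?_, ?_, ?_, ?_, ?_⟩
  · intro i y hy
    have := (hUs hy).1.1 i
    exact (analyticAt_snd.mul (analyticAt_fst.fun_comp this)).prod (analyticAt_snd.fun_comp this)
  · intro y hy
    have := analyticAt_logConnection (hUs hy).1.1 (hUs hy).1.2.1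
    exact (analyticAt_fst.fun_comp this).prod
      ((analyticAt_snd.fun_comp this).div analyticAt_snd (hUs hy).2)
  · intro y hy v
    exact (hUs hy).1.2.2 v
  · intro y hy i j hij
    rw [hw]
    exact mul_ne_zero (hUs hy).2 ((hUs hy).1.2.1 i j hij)
  · intro y hy i
    have e : (fun t : ℂ × ℂ => wedge (t.2 * (a (i + 1) t).1, (a (i + 1) t).2)
        (t.2 * (a (i + 2) t).1, (a (i + 2) t).2) • (t.2 * (a i t).1, (a i t).2)) =
        fun t => (t.2 ^ 2 * (normalForm a i t).1, t.2 * (normalForm a i t).2) := by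
      funext t
      rw [hw]
      ext <;> simp only [normalForm, Prod.smul_fst, Prod.smul_snd, smul_eq_mul] <;> ring
    rw [e, extD_log (analyticAt_normalForm (hUs hy).1.1 i), congrFun e y,
      ← wedge_normalForm_logConnection (hUs hy).1.1 (hUs hy).1.2.1]
    have := (hUs hy).2
    simp only [wedge]
    field_simp
  · have hc := analyticAt_logConnection (hUs hzU).1.1 (hUs hzU).1.2.1
    have h2 : HasFDerivAt (fun t => (logConnection a t).2) (fderiv ℂ (fun t => (logConnection a t).2) z) z :=
      hc.differentiableAt.snd.hasFDerivAt
    have hq : HasFDerivAt (fun y : ℂ × ℂ => y.2⁻¹) _ z :=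
      (hasDerivAt_inv hz).comp_hasFDerivAt z (hasFDerivAt_snd (𝕜 := ℂ) (p := z))
    simp only [logCurvature, extD, div_eq_mul_inv]
    rw [(h2.fun_mul hq).fderiv]
    simp
    ring

theorem fderiv_apply_one_zero {f : ℂ × ℂ → ℂ} (hf : DifferentiableAt ℂ f z) :
    fderiv ℂ f z (1, 0) = deriv (fun p => f (p, z.2)) z.1 := by
  have h2 : HasDerivAt (fun p : ℂ => (p, z.2)) (1, 0) z.1 :=
    (hasDerivAt_id z.1).prodMk (hasDerivAt_const z.1 z.2)
  exact ((hf.hasFDerivAt (x := z)).comp_hasDerivAt z.1 h2).deriv.symm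

/-- On `q = 0` the only transverse derivative in `logExtD` is multiplied by `q = 0`, and
`p`-derivatives see only the restriction to that line. -/
theorem logConnection_snd_congr {p₀ : ℂ} (ha : ∀ i, AnalyticAt ℂ (a i) (p₀, 0))
    (ha' : ∀ i, AnalyticAt ℂ (a' i) (p₀, 0)) (h : ∀ᶠ p in 𝓝 p₀, ∀ i, a i (p, 0) = a' i (p, 0)) :
    logConnection a (p₀, 0) = logConnection a' (p₀, 0) := by
  have hE : ∀ i, logExtD (normalForm a i) (p₀, 0) = logExtD (normalForm a' i) (p₀, 0) := fun i => by
    have hn : (fun p => normalForm a i (p, 0)) =ᶠ[𝓝 p₀] fun p => normalForm a' i (p, 0) := by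
      filter_upwards [h] with p hp
      simp only [normalForm, hp]
    have hn2 : (fun p => (normalForm a i (p, 0)).2) =ᶠ[𝓝 p₀] fun p => (normalForm a' i (p, 0)).2 :=
      hn.fun_comp Prod.snd
    have hp := hn.self_of_nhds
    simp only at hp
    simp only [logExtD]
    rw [fderiv_apply_one_zero (analyticAt_normalForm ha i).differentiableAt.snd,
      fderiv_apply_one_zero (analyticAt_normalForm ha' i).differentiableAt.snd,
      hn2.deriv_eq, hp]
    simp
  simp only [logConnection, hE, h.self_of_nhds]

/-- Two logarithmic webs with the same restriction to `q = 0` have curvatures with the same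
polar part. -/
theorem exists_logCurvature_eq_add {p₀ : ℂ} (ha : ∀ i, AnalyticAt ℂ (a i) (p₀, 0))
    (ha' : ∀ i, AnalyticAt ℂ (a' i) (p₀, 0)) (h : ∀ᶠ p in 𝓝 p₀, ∀ i, a i (p, 0) = a' i (p, 0))
    (hind : ∀ i j, i ≠ j → wedge (a i (p₀, 0)) (a j (p₀, 0)) ≠ 0) :
    ∃ g : ℂ × ℂ → ℂ, AnalyticAt ℂ g (p₀, 0) ∧ ∀ᶠ z in 𝓝 (p₀, 0), z.2 ≠ 0 →
      logCurvature a' z = logCurvature a z + g z := by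
  have hind' : ∀ i j, i ≠ j → wedge (a' i (p₀, 0)) (a' j (p₀, 0)) ≠ 0 := by
    have := h.self_of_nhds
    simpa only [this] using hind
  have hc := analyticAt_logConnection ha hind
  have hc' := analyticAt_logConnection ha' hind'
  have t : Filter.Tendsto (fun p : ℂ => (p, (0 : ℂ))) (𝓝 p₀) (𝓝 (p₀, 0)) :=
    (by fun_prop : Continuous fun p : ℂ => (p, (0 : ℂ))).tendsto p₀
  have h0 : ∀ᶠ p in 𝓝 p₀, (logConnection a' (p, 0)).2 - (logConnection a (p, 0)).2 = 0 := by
    filter_upwards [h.eventually_nhds,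
      t (Filter.eventually_all.2 fun i => (ha i).eventually_analyticAt),
      t (Filter.eventually_all.2 fun i => (ha' i).eventually_analyticAt)] with p hp h1 h2
    rw [logConnection_snd_congr h1 h2 hp, sub_self]
  -- The two coefficients of `dq/q` differ by `q γ`, which contributes `∂_p (q γ) / q = ∂_p γ` to
  -- the curvature, without pole.
  obtain ⟨γ, hγ, hγe⟩ := ((analyticAt_snd.fun_comp hc').fun_sub
    (analyticAt_snd.fun_comp hc)).exists_eq_snd_mul h0
  refine ⟨fun z => fderiv ℂ γ z (1, 0) - (fderiv ℂ (fun y => (logConnection a' y).1) z (0, 1) -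
    fderiv ℂ (fun y => (logConnection a y).1) z (0, 1)), ?_, ?_⟩
  · exact (analyticAt_fderiv_apply hγ _).sub
      ((analyticAt_fderiv_apply (analyticAt_fst.fun_comp hc') _).sub
        (analyticAt_fderiv_apply (analyticAt_fst.fun_comp hc) _))
  · filter_upwards [hγe.eventually_nhds, hγ.eventually_analyticAt, hc.eventually_analyticAt,
      hc'.eventually_analyticAt] with z h1 h2 h3 h4 hz
    have e1 : fderiv ℂ (fun y => (logConnection a' y).2 - (logConnection a y).2) z =
        fderiv ℂ (fun y : ℂ × ℂ => y.2 * γ y) z := Filter.EventuallyEq.fderiv_eq h1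
    rw [fderiv_fun_sub h4.differentiableAt.snd h3.differentiableAt.snd,
      ((hasFDerivAt_snd (𝕜 := ℂ) (p := z)).fun_mul h2.differentiableAt.hasFDerivAt).fderiv] at e1
    have e2 := congrArg (fun L : ℂ × ℂ →L[ℂ] ℂ => L (1, 0)) e1
    simp at e2
    simp only [logCurvature]
    rw [sub_eq_iff_eq_add] at e2
    rw [e2]
    field_simp
    ring

/-! ### Multiple roots and pencils of binary cubic forms -/

/-- The gradient of a binary cubic form vanishes at `v`; for `v ≠ 0` this means that `v` spans a
multiple root. -/
def IsCriticalPoint (c : Fin 4 → ℂ) (v : ℂ × ℂ) : Prop :=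
  3 * c 0 * v.1 ^ 2 + 2 * c 1 * v.1 * v.2 + c 2 * v.2 ^ 2 = 0 ∧
    c 1 * v.1 ^ 2 + 2 * c 2 * v.1 * v.2 + 3 * c 3 * v.2 ^ 2 = 0

/-- The condition is homogeneous in `v`. The representative `w` does not depend on `c`, so it serves
several forms at once. -/
theorem IsCriticalPoint.normalize {v : ℂ × ℂ} (hv : v ≠ 0) :
    ∃ w : ℂ × ℂ, (w = (1, 0) ∨ ∃ r, w = (r, 1)) ∧
      ∀ c, IsCriticalPoint c v → IsCriticalPoint c w := by
  obtain ⟨x, y⟩ := v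
  by_cases hy : y = 0
  · subst hy
    have hx : x ≠ 0 := fun h => hv (by simp [h])
    refine ⟨(1, 0), Or.inl rfl, fun c h => ?_⟩
    simpa [IsCriticalPoint, hx] using h
  · refine ⟨(x / y, 1), Or.inr ⟨_, rfl⟩, fun c ⟨h1, h2⟩ => ⟨?_, ?_⟩⟩
    · simp only at h1 ⊢
      field_simp
      linear_combination h1
    · simp only at h2 ⊢
      field_simp
      linear_combination h2

theorem exists_factorization_of_roots {c : Fin 4 → ℂ} {k x y z : ℂ} (hk : k ≠ 0)
    (h0 : c 0 = k) (h1 : c 1 = k * -(x + y + z)) (h2 : c 2 = k * (x * y + x * z + y * z))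
    (h3 : c 3 = k * -(x * y * z)) (h : ∀ v, v ≠ 0 → ¬ IsCriticalPoint c v) :
    ∃ α : Fin 3 → ℂ × ℂ, (∀ v, binaryCubic c v = ∏ i, apply (α i) v) ∧
      ∀ i j, i ≠ j → wedge (α i) (α j) ≠ 0 := by
  have hxy : x - y ≠ 0 := fun e => h (x, 1) (by simp) (by
    obtain rfl := sub_eq_zero.1 e
    simp only [IsCriticalPoint, h0, h1, h2, h3]; constructor <;> ring)
  have hxz : x - z ≠ 0 := fun e => h (x, 1) (by simp) (by
    obtain rfl := sub_eq_zero.1 e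
    simp only [IsCriticalPoint, h0, h1, h2, h3]; constructor <;> ring)
  have hyz : y - z ≠ 0 := fun e => h (y, 1) (by simp) (by
    obtain rfl := sub_eq_zero.1 e
    simp only [IsCriticalPoint, h0, h1, h2, h3]; constructor <;> ring)
  have hyx : y - x ≠ 0 := fun e => hxy (by linear_combination -e)
  have hzx : z - x ≠ 0 := fun e => hxz (by linear_combination -e)
  have hzy : z - y ≠ 0 := fun e => hyz (by linear_combination -e)
  refine ⟨![(k, -(k * x)), (1, -y), (1, -z)], fun v => ?_, fun i j hij => ?_⟩
  · simp only [Fin.prod_univ_three, binaryCubic, apply, h0, h1, h2, h3]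
    simp
    ring
  · have e1 : k * -y - -(k * x) * 1 = k * (x - y) := by ring
    have e2 : k * -z - -(k * x) * 1 = k * (x - z) := by ring
    have e3 : (1 : ℂ) * -(k * x) - -y * k = k * (y - x) := by ring
    have e4 : (1 : ℂ) * -(k * x) - -z * k = k * (z - x) := by ring
    have e5 : (1 : ℂ) * -z - -y * 1 = y - z := by ring
    have e6 : (1 : ℂ) * -y - -z * 1 = z - y := by ring
    fin_cases i <;> fin_cases j <;> first | exact absurd rfl hij | skip
    · change k * -y - -(k * x) * 1 ≠ 0; rw [e1]; exact mul_ne_zero hk hxy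
    · change k * -z - -(k * x) * 1 ≠ 0; rw [e2]; exact mul_ne_zero hk hxz
    · change (1 : ℂ) * -(k * x) - -y * k ≠ 0; rw [e3]; exact mul_ne_zero hk hyx
    · change (1 : ℂ) * -z - -y * 1 ≠ 0; rw [e5]; exact hyz
    · change (1 : ℂ) * -(k * x) - -z * k ≠ 0; rw [e4]; exact mul_ne_zero hk hzx
    · change (1 : ℂ) * -y - -z * 1 ≠ 0; rw [e6]; exact hzy

/-- A binary cubic form over `ℂ` without multiple roots is a product of pairwise independent linear
forms. -/
theorem exists_factorization {c : Fin 4 → ℂ} (h : ∀ v, v ≠ 0 → ¬ IsCriticalPoint c v) :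
    ∃ α : Fin 3 → ℂ × ℂ, (∀ v, binaryCubic c v = ∏ i, apply (α i) v) ∧
      ∀ i j, i ≠ j → wedge (α i) (α j) ≠ 0 := by
  by_cases h0 : c 0 = 0
  · have h1 : c 1 ≠ 0 := fun h1 => h (1, 0) (by simp) (by simp [IsCriticalPoint, h0, h1])
    -- Here `v.2` splits off, and `s` is a square root of the discriminant of the quadratic
    -- cofactor; if `s = 0`, then `(-c 2, 2 * c 1)` is its double root.
    obtain ⟨s, hs⟩ := IsAlgClosed.exists_pow_nat_eq (c 2 ^ 2 - 4 * c 1 * c 3) two_pos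
    have hs0 : s ≠ 0 := fun hs0 => h (-c 2, 2 * c 1) (by simp [h1]) (by
      rw [hs0] at hs
      simp only [IsCriticalPoint, h0]
      constructor
      · ring
      · linear_combination (3 * c 1) * hs)
    refine ⟨![(0, 1), (c 1, (c 2 - s) / 2), (1, (c 2 + s) / (2 * c 1))], fun v => ?_,
      fun i j hij => ?_⟩
    · simp only [Fin.prod_univ_three, binaryCubic, apply, h0]
      simp
      field_simp
      linear_combination v.2 ^ 3 * hs
    · have e : c 1 * ((c 2 + s) / (2 * c 1)) - (c 2 - s) / 2 * 1 = s := by field_simp; ring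
      have e' : 1 * ((c 2 - s) / 2) - (c 2 + s) / (2 * c 1) * c 1 = -s := by field_simp; ring
      fin_cases i <;> fin_cases j <;> first | exact absurd rfl hij | skip
      · simpa [wedge] using h1
      · simp [wedge]
      · simpa [wedge] using h1
      · change c 1 * ((c 2 + s) / (2 * c 1)) - (c 2 - s) / 2 * 1 ≠ 0
        rwa [e]
      · simp [wedge]
      · change 1 * ((c 2 - s) / 2) - (c 2 + s) / (2 * c 1) * c 1 ≠ 0
        rw [e']; exact neg_ne_zero.2 hs0
  · let P : Cubic ℂ := ⟨c 0, c 1, c 2, c 3⟩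
    obtain ⟨x, y, z, hr⟩ := (Cubic.splits_iff_roots_eq_three (P := P) (φ := RingHom.id ℂ) h0).1
      (IsAlgClosed.splits _)
    exact exists_factorization_of_roots h0 rfl (Cubic.b_eq_three_roots (P := P) h0 hr)
      (Cubic.c_eq_three_roots (P := P) h0 hr) (Cubic.d_eq_three_roots (P := P) h0 hr) h

theorem isCriticalPoint_of_pencil {a b : Fin 4 → ℂ} {v : ℂ × ℂ} {p p' : ℂ} (hp : p ≠ p')
    (h : IsCriticalPoint (p • a - b) v) (h' : IsCriticalPoint (p' • a - b) v) :
    IsCriticalPoint a v ∧ IsCriticalPoint b v := by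
  have hne : p - p' ≠ 0 := sub_ne_zero.2 hp
  simp only [IsCriticalPoint, Pi.sub_apply, Pi.smul_apply, smul_eq_mul] at *
  obtain ⟨h1, h2⟩ := h
  obtain ⟨h1', h2'⟩ := h'
  refine ⟨⟨mul_left_cancel₀ hne ?_, mul_left_cancel₀ hne ?_⟩,
    ⟨mul_left_cancel₀ hne ?_, mul_left_cancel₀ hne ?_⟩⟩
  · linear_combination h1 - h1'
  · linear_combination h2 - h2'
  · linear_combination p' * h1 - p * h1'
  · linear_combination p' * h2 - p * h2'

theorem isCriticalPoint_smul {c : Fin 4 → ℂ} {v : ℂ × ℂ} {k : ℂ} (hk : k ≠ 0) :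
    IsCriticalPoint (k • c) v ↔ IsCriticalPoint c v := by
  have e1 : 3 * (k * c 0) * v.1 ^ 2 + 2 * (k * c 1) * v.1 * v.2 + k * c 2 * v.2 ^ 2 =
      k * (3 * c 0 * v.1 ^ 2 + 2 * c 1 * v.1 * v.2 + c 2 * v.2 ^ 2) := by ring
  have e2 : k * c 1 * v.1 ^ 2 + 2 * (k * c 2) * v.1 * v.2 + 3 * (k * c 3) * v.2 ^ 2 =
      k * (c 1 * v.1 ^ 2 + 2 * c 2 * v.1 * v.2 + 3 * c 3 * v.2 ^ 2) := by ring
  simp only [IsCriticalPoint, Pi.smul_apply, smul_eq_mul, e1, e2, mul_eq_zero, hk, false_or]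

/-- The Jacobian determinant of two binary cubic forms, in the affine coordinate. -/
noncomputable def jacobian (a b : Fin 4 → ℂ) : Polynomial ℂ :=
  ∑ i : Fin 5, Polynomial.monomial (4 - i : ℕ)
    ((![3 * (a 0 * b 1 - a 1 * b 0), 6 * (a 0 * b 2 - a 2 * b 0),
      9 * (a 0 * b 3 - a 3 * b 0) + 3 * (a 1 * b 2 - a 2 * b 1),
      6 * (a 1 * b 3 - a 3 * b 1), 3 * (a 2 * b 3 - a 3 * b 2)] : Fin 5 → ℂ) i)

/-- A critical point of a member makes the gradients of `a` and `b` dependent there, whatever `p`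
is. -/
theorem isRoot_jacobian {a b : Fin 4 → ℂ} {p r : ℂ} (h : IsCriticalPoint (p • a - b) (r, 1)) :
    (jacobian a b).IsRoot r := by
  simp only [IsCriticalPoint, Pi.sub_apply, Pi.smul_apply, smul_eq_mul] at h
  obtain ⟨h1, h2⟩ := h
  simp only [jacobian, Polynomial.IsRoot, Fin.sum_univ_five, Polynomial.eval_add,
    Polynomial.eval_monomial]
  simp
  linear_combination (a 1 * r ^ 2 + 2 * a 2 * r + 3 * a 3) * h1 -
    (3 * a 0 * r ^ 2 + 2 * a 1 * r + a 2) * h2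

theorem minors_eq_zero_of_jacobian_eq_zero {a b : Fin 4 → ℂ} (h : jacobian a b = 0) (i j : Fin 4) :
    a i * b j - a j * b i = 0 := by
  have hc := fun n => congrArg (fun P => Polynomial.coeff P n) h
  simp only [jacobian, Fin.sum_univ_five, Polynomial.coeff_add, Polynomial.coeff_monomial,
    Polynomial.coeff_zero] at hc
  have m01 : a 0 * b 1 - a 1 * b 0 = 0 := by simpa using hc 4
  have m02 : a 0 * b 2 - a 2 * b 0 = 0 := by simpa using hc 3
  have m03' : 9 * (a 0 * b 3 - a 3 * b 0) + 3 * (a 1 * b 2 - a 2 * b 1) = 0 := by simpa using hc 2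
  have m13 : a 1 * b 3 - a 3 * b 1 = 0 := by simpa using hc 1
  have m23 : a 2 * b 3 - a 3 * b 2 = 0 := by simpa using hc 0
  have m03 : a 0 * b 3 - a 3 * b 0 = 0 := by
    -- The middle coefficient mixes two minors; the Plücker relation `m01 m23 - m02 m13 + m03 m12 =
    -- 0` separates them.
    have : (a 0 * b 3 - a 3 * b 0) ^ 2 = 0 := by
      linear_combination (a 0 * b 3 - a 3 * b 0) / 9 * m03' + (a 2 * b 3 - a 3 * b 2) / 3 * m01 -
        (a 1 * b 3 - a 3 * b 1) / 3 * m02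
    simpa using this
  have m12 : a 1 * b 2 - a 2 * b 1 = 0 := by linear_combination (m03' - 9 * m03) / 3
  fin_cases i <;> fin_cases j <;> simp <;>
    first
    | ring1
    | linear_combination m01
    | linear_combination m02
    | linear_combination m03
    | linear_combination m12
    | linear_combination m13
    | linear_combination m23
    | linear_combination -m01
    | linear_combination -m02
    | linear_combination -m03
    | linear_combination -m12
    | linear_combination -m13
    | linear_combination -m23

/-- A pencil of binary cubic forms without common multiple root has only finitely many members with
a multiple root. -/
theorem finite_pencil_isCriticalPoint {a b : Fin 4 → ℂ}
    (h : ∀ v, v ≠ 0 → ¬ (IsCriticalPoint a v ∧ IsCriticalPoint b v)) :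
    {p : ℂ | ∃ v, v ≠ 0 ∧ IsCriticalPoint (p • a - b) v}.Finite := by
  -- A vector critical for two members is critical for `a` and `b`, so each direction accounts for
  -- at most one `p`. If the Jacobian is nonzero, only finitely many directions occur; otherwise `a`
  -- and `b` are proportional.
  have hsub : ∀ v, v ≠ 0 → {p : ℂ | IsCriticalPoint (p • a - b) v}.Finite := fun v hv =>
    Set.Subsingleton.finite fun p hp p' hp' => by
      by_contra hne
      exact h v hv (isCriticalPoint_of_pencil hne hp hp')
  by_cases hJ : jacobian a b = 0
  · have hm := minors_eq_zero_of_jacobian_eq_zero hJ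
    by_cases ha : a = 0
    · refine Set.finite_empty.subset fun p ⟨v, hv, hp⟩ => h v hv ?_
      rw [ha, smul_zero, zero_sub, ← neg_one_smul ℂ b, isCriticalPoint_smul (by simp)] at hp
      exact ⟨by simp [ha, IsCriticalPoint], hp⟩
    · obtain ⟨i, hi⟩ := Function.ne_iff.1 ha
      have hb : b = (b i / a i) • a := by
        ext j
        simp only [Pi.smul_apply, smul_eq_mul]
        have := hm i j
        have hi' : a i ≠ 0 := hi
        field_simp
        linear_combination this
      refine (Set.finite_singleton (b i / a i)).subset fun p ⟨v, hv, hp⟩ => ?_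
      by_contra hne
      generalize b i / a i = β at hb hne
      subst hb
      rw [← sub_smul, isCriticalPoint_smul (sub_ne_zero.2 hne)] at hp
      refine h v hv ⟨hp, ?_⟩
      by_cases hβ : β = 0
      · simp [hβ, IsCriticalPoint]
      · exact (isCriticalPoint_smul hβ).2 hp
  · refine ((hsub (1, 0) (by simp)).union ((jacobian a b).roots.toFinset.finite_toSet.biUnion
      (t := fun r => {p : ℂ | IsCriticalPoint (p • a - b) (r, 1)})
      fun r _ => hsub (r, 1) (by simp))).subset ?_
    rintro p ⟨v, hv, hp⟩
    obtain ⟨w, hw, hcw⟩ := IsCriticalPoint.normalize hv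
    rcases hw with rfl | ⟨r, rfl⟩
    · exact Or.inl (hcw _ hp)
    · refine Or.inr (Set.mem_biUnion ?_ (hcw _ hp))
      simpa [hJ] using isRoot_jacobian (hcw _ hp)

/-! ### Binary cubic forms as homogeneous polynomials -/

/-- The binary cubic form as a polynomial. -/
noncomputable def cubicPolynomial (c : Fin 4 → ℂ) : MvPolynomial (Fin 2) ℂ :=
  ∑ i : Fin 4, MvPolynomial.C (c i) * MvPolynomial.X 0 ^ (3 - i : ℕ) * MvPolynomial.X 1 ^ (i : ℕ)

theorem eval_cubicPolynomial (c : Fin 4 → ℂ) (x y : ℂ) :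
    MvPolynomial.eval ![x, y] (cubicPolynomial c) = binaryCubic c (x, y) := by
  simp [cubicPolynomial, Fin.sum_univ_four, binaryCubic]

theorem exists_eq_cubicPolynomial {P : MvPolynomial (Fin 2) ℂ} (hP : P.IsHomogeneous 3) :
    ∃ c, P = cubicPolynomial c := by
  let s : Fin 4 → Fin 2 →₀ ℕ := fun i =>
    Finsupp.single 0 (3 - i : ℕ) + Finsupp.single 1 (i : ℕ)
  have hs : Function.Injective s := fun i j hij => by
    have := DFunLike.congr_fun hij 1
    simpa [s, Fin.ext_iff] using this
  refine ⟨fun i => P.coeff (s i), ?_⟩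
  have hmon : ∀ i : Fin 4, MvPolynomial.C (P.coeff (s i)) * MvPolynomial.X 0 ^ (3 - i : ℕ) *
      MvPolynomial.X 1 ^ (i : ℕ) = MvPolynomial.monomial (s i) (P.coeff (s i)) := fun i => by
    rw [MvPolynomial.X_pow_eq_monomial, MvPolynomial.X_pow_eq_monomial,
      MvPolynomial.C_mul_monomial, MvPolynomial.monomial_mul, mul_one, mul_one]
  simp only [cubicPolynomial, hmon]
  ext d
  rw [MvPolynomial.coeff_sum]
  simp only [MvPolynomial.coeff_monomial]
  by_cases hd : ∃ i, s i = d
  · obtain ⟨i, rfl⟩ := hd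
    simp [hs.eq_iff]
  · push Not at hd
    rw [Finset.sum_eq_zero fun i _ => by simp [hd i]]
    refine hP.coeff_eq_zero fun hdeg => ?_
    have hsum : d 0 + d 1 = 3 := by
      rw [← hdeg, Finsupp.degree_eq_sum, Fin.sum_univ_two]
    refine hd ⟨d 1, by omega⟩ ?_
    ext k
    fin_cases k
    · simp [s]; omega
    · simp [s]

/-- `L` is a linear form vanishing at `v`. It is chosen before `c`, so a common critical point gives
a common square factor. -/
theorem sq_dvd_cubicPolynomial_of_isCriticalPoint {v : ℂ × ℂ} (hv : v ≠ 0) :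
    ∃ L : MvPolynomial (Fin 2) ℂ, ¬ IsUnit L ∧
      ∀ c, IsCriticalPoint c v → L ^ 2 ∣ cubicPolynomial c := by
  have hunit : ∀ L : MvPolynomial (Fin 2) ℂ, MvPolynomial.eval 0 L = 0 → ¬ IsUnit L :=
    fun L h hL => not_isUnit_zero (h ▸ hL.map (MvPolynomial.eval 0))
  obtain ⟨w, hw, hcw⟩ := IsCriticalPoint.normalize hv
  rcases hw with rfl | ⟨r, rfl⟩
  · refine ⟨MvPolynomial.X 1, hunit _ (by simp), fun c hc => ?_⟩
    have h1 := hcw c hc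
    simp [IsCriticalPoint] at h1
    refine ⟨MvPolynomial.C (c 2) * MvPolynomial.X 0 + MvPolynomial.C (c 3) * MvPolynomial.X 1, ?_⟩
    simp [cubicPolynomial, Fin.sum_univ_four, h1]
    ring
  · refine ⟨MvPolynomial.X 0 - MvPolynomial.C r * MvPolynomial.X 1, hunit _ (by simp),
      fun c hc => ?_⟩
    obtain ⟨h1, h2⟩ := hcw c hc
    simp only at h1 h2
    have e2 : c 2 = -(3 * c 0 * r ^ 2 + 2 * c 1 * r) := by linear_combination h1
    have e3 : c 3 = c 1 * r ^ 2 + 2 * c 0 * r ^ 3 := by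
      linear_combination (h2 - 2 * r * h1) / 3
    refine ⟨MvPolynomial.C (c 0) * MvPolynomial.X 0 +
      MvPolynomial.C (c 1 + 2 * r * c 0) * MvPolynomial.X 1, ?_⟩
    have c2 : (MvPolynomial.C 2 : MvPolynomial (Fin 2) ℂ) = 2 := map_ofNat _ 2
    have c3 : (MvPolynomial.C 3 : MvPolynomial (Fin 2) ℂ) = 3 := map_ofNat _ 3
    simp [cubicPolynomial, Fin.sum_univ_four, e2, e3, c2, c3]
    ring

/-! ### The Legendre transform in the logarithmic frame -/

/-- The Legendre transform of the vector field with components `a + x h`, `b + y h`, where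
`a, b, h` are binary cubic forms. -/
def radialWeb (a b h : Fin 4 → ℂ) (z v : ℂ × ℂ) : ℂ :=
  binaryCubic (z.1 • a - b - z.2 • h) (-v.2, z.2 * v.1 - z.1 * v.2)

/-- The coefficients of the binary cubic form `n (-v₂, v₁ - p v₂)`. -/
def chartCubic (p : ℂ) (n : Fin 4 → ℂ) : Fin 4 → ℂ :=
  ![n 3, -n 2 - 3 * p * n 3, n 1 + 2 * p * n 2 + 3 * p ^ 2 * n 3,
    -n 0 - p * n 1 - p ^ 2 * n 2 - p ^ 3 * n 3]

theorem binaryCubic_chartCubic (p : ℂ) (n : Fin 4 → ℂ) (v : ℂ × ℂ) :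
    binaryCubic (chartCubic p n) v = binaryCubic n (-v.2, v.1 - p * v.2) := by
  simp [binaryCubic, chartCubic]
  ring

/-- The coefficients of `radialWeb` in the logarithmic frame `dp, dq / q`, up to the factor
`q ^ 3`. -/
def radialCoeff (a b h : Fin 4 → ℂ) (z : ℂ × ℂ) : Fin 4 → ℂ :=
  chartCubic z.1 (z.1 • a - b - z.2 • h)

theorem analyticAt_radialCoeff (a b h : Fin 4 → ℂ) (z : ℂ × ℂ) :
    AnalyticAt ℂ (radialCoeff a b h) z := by
  have hn : ∀ i, AnalyticAt ℂ (fun y : ℂ × ℂ => (y.1 • a - b - y.2 • h) i) z := fun i => by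
    simp only [Pi.sub_apply, Pi.smul_apply, smul_eq_mul]
    exact ((analyticAt_fst.mul analyticAt_const).sub analyticAt_const).sub
      (analyticAt_snd.mul analyticAt_const)
  have h0 := hn 0
  have h1 := hn 1
  have h2 := hn 2
  have h3 := hn 3
  refine analyticAt_pi_iff.2 fun i => ?_
  fin_cases i
  · exact h3
  · exact h2.neg.sub ((analyticAt_const.mul analyticAt_fst).mul h3)
  · exact (h1.add ((analyticAt_const.mul analyticAt_fst).mul h2)).add
      ((analyticAt_const.mul (analyticAt_fst.pow 2)).mul h3)
  · exact ((h0.neg.sub (analyticAt_fst.mul h1)).sub ((analyticAt_fst.pow 2).mul h2)).sub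
      ((analyticAt_fst.pow 3).mul h3)

theorem radialWeb_eq {a b h : Fin 4 → ℂ} {z : ℂ × ℂ} (hz : z.2 ≠ 0) (v : ℂ × ℂ) :
    radialWeb a b h z v = z.2 ^ 3 * binaryCubic (radialCoeff a b h z) (v.1, v.2 / z.2) := by
  rw [radialCoeff, binaryCubic_chartCubic]
  simp only [radialWeb, binaryCubic]
  field_simp

theorem radialWeb_eq_cube (a b h : Fin 4 → ℂ) (p : ℂ) : ∃ k, ∀ v,
    radialWeb a b h (p, 0) v = k * v.2 ^ 3 :=
  ⟨binaryCubic (p • a - b) (-1, -p), fun v => by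
    simp only [radialWeb, binaryCubic, zero_smul, sub_zero]; ring⟩

theorem hasCurvatureAt_radialWeb {a b h : Fin 4 → ℂ} {p₀ : ℂ}
    {f : Fin 3 → (Fin 4 → ℂ) → ℂ × ℂ} (hf : ∀ i, AnalyticAt ℂ (f i) (radialCoeff a b h (p₀, 0)))
    (hfac : ∀ᶠ c in 𝓝 (radialCoeff a b h (p₀, 0)), (∀ v, binaryCubic c v = ∏ i, apply (f i c) v) ∧
      ∀ i j, i ≠ j → wedge (f i c) (f j c) ≠ 0) :
    ∀ᶠ z in 𝓝 (p₀, (0 : ℂ)), z.2 ≠ 0 → HasCurvatureAt (radialWeb a b h) z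
      (logCurvature (fun i y => f i (radialCoeff a b h y)) z) := by
  have hN := analyticAt_radialCoeff a b h (p₀, 0)
  have hfa : ∀ᶠ z in 𝓝 (p₀, (0 : ℂ)), ∀ i, AnalyticAt ℂ (fun y => f i (radialCoeff a b h y)) z :=
    Filter.eventually_all.2 fun i => ((hf i).fun_comp hN).eventually_analyticAt
  filter_upwards [hfa.eventually_nhds, (hN.continuousAt.eventually hfac).eventually_nhds]
    with z h1 h2 hz
  refine hasCurvatureAt_logCurvature hz ?_
  filter_upwards [h1, h2, continuous_snd.continuousAt.eventually_ne hz] with y k1 k2 hy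
  refine ⟨k1, k2.2, fun v => ?_⟩
  rw [radialWeb_eq hy, k2.1, Fin.prod_univ_three, Fin.prod_univ_three]
  simp only [apply]
  field_simp

/-- On `q = 0` the coefficients for `h` and `h'` agree, so one analytic factorization `f` serves
both webs, and the two logarithmic forms agree there factor by factor. -/
theorem curvatureHolomorphicAt_radialWeb {a b h h' : Fin 4 → ℂ} {c c' p₀ : ℂ} (hc : c ≠ 0)
    (hc' : c' ≠ 0) (hp : ∀ v, v ≠ 0 → ¬ IsCriticalPoint (p₀ • a - b) v)
    (hW : CurvatureHolomorphicAt (fun z v => c * radialWeb a b h z v) (p₀, 0)) :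
    CurvatureHolomorphicAt (fun z v => c' * radialWeb a b h' z v) (p₀, 0) := by
  have hN0 : ∀ h p, radialCoeff a b h (p, 0) = chartCubic p (p • a - b) := fun h p => by
    simp [radialCoeff]
  obtain ⟨α, hα, hαi⟩ := exists_factorization hp
  obtain ⟨f, hf, hfac⟩ := exists_analyticAt_factorization
    -- Pullback of `α i` under `v ↦ (-v.2, v.1 - p₀ v.2)`.
    (c₀ := chartCubic p₀ (p₀ • a - b)) (α := fun i => ((α i).2, -(α i).1 - p₀ * (α i).2))
    (fun v => by
      rw [binaryCubic_chartCubic, hα]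
      refine Finset.prod_congr rfl fun i _ => ?_
      simp only [apply]; ring)
    (fun i j hij => by
      have := hαi i j hij
      simp only [wedge] at this ⊢
      intro e; exact this (by linear_combination e))
  have hf1 : ∀ h i, AnalyticAt ℂ (fun z => f i (radialCoeff a b h z)) (p₀, 0) := fun h i =>
    AnalyticAt.fun_comp (by rw [hN0]; exact hf i) (analyticAt_radialCoeff a b h _)
  have K := hasCurvatureAt_radialWeb (a := a) (b := b) (h := h) (p₀ := p₀) (f := f)
    (by rwa [hN0]) (by rwa [hN0])
  have K' := hasCurvatureAt_radialWeb (a := a) (b := b) (h := h') (p₀ := p₀) (f := f)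
    (by rwa [hN0]) (by rwa [hN0])
  obtain ⟨g, hg, hgK⟩ := exists_logCurvature_eq_add (hf1 h) (hf1 h')
    (Filter.Eventually.of_forall fun p i => by rw [hN0, hN0])
    (by simpa only [hN0] using hfac.self_of_nhds.2)
  obtain ⟨φ, hφ, hφK⟩ := hW
  refine ⟨fun z => φ z + g z, hφ.add hg, ?_⟩
  filter_upwards [K, K', hgK, hφK] with z k1 k2 k3 k4 hz
  -- On `q = 0` the web is a multiple of `dq³`, so that line lies in the discriminant.
  have hq : z.2 ≠ 0 := fun hq => hz <| by
    obtain ⟨p, q⟩ := z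
    obtain rfl : q = 0 := hq
    obtain ⟨k, hk⟩ := radialWeb_eq_cube a b h' p
    exact mem_discriminant_of_cube (k := c' * k) fun v => by rw [hk, mul_assoc]
  have e1 := (k1 hq).const_mul hc
  have e2 := k4 e1.notMem_discriminant
  rw [e2.unique e1, ← k3 hq]
  exact (k2 hq).const_mul hc'

end PlaneWeb

/-! ### From foliations to webs, and the conclusion -/

namespace PlaneFoliation

open PlaneWeb

theorem eval_dehomogenize (P : MvPolynomial (Fin 3) ℂ) (x y : ℂ) :
    MvPolynomial.eval ![x, y] (dehomogenize P) = MvPolynomial.eval ![x, y, 1] P := by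
  rw [dehomogenize, ← MvPolynomial.coe_aeval_eq_eval, RingHom.coe_coe,
    MvPolynomial.comp_aeval_apply, ← MvPolynomial.coe_aeval_eq_eval, RingHom.coe_coe]
  congr 2
  ext i
  fin_cases i <;> simp

theorem eval_smul_of_isHomogeneous {σ : Type*} {P : MvPolynomial σ ℂ} {n : ℕ}
    (hP : P.IsHomogeneous n) (t : ℂ) (x : σ → ℂ) :
    MvPolynomial.eval (t • x) P = t ^ n * MvPolynomial.eval x P := by
  rw [MvPolynomial.eval_eq, MvPolynomial.eval_eq, Finset.mul_sum]
  refine Finset.sum_congr rfl fun d hd => ?_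
  have hdeg : ∑ i ∈ d.support, d i = n := (hP.degree_eq_sum_deg_support hd).symm
  simp only [Pi.smul_apply, smul_eq_mul, mul_pow, Finset.prod_mul_distrib]
  rw [Finset.prod_pow_eq_pow_sum, hdeg]
  ring

/-- At `m = (x, y, 1)` with `y = p x + q` one has `p V₀ - V₁ + q V₂ = p (V₀ - x V₂) - (V₁ - y V₂)`,
and the radial term contributes `h (p x - y) = -q h`. -/
theorem leg_eq_radialWeb {F : PlaneFoliation 3} {a b h : Fin 4 → ℂ}
    {V : Fin 2 → MvPolynomial (Fin 2) ℂ} {c : ℂ} (hF : F.affineField = c • V)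
    (h0 : V 0 = cubicPolynomial a + cubicPolynomial h * MvPolynomial.X 0)
    (h1 : V 1 = cubicPolynomial b + cubicPolynomial h * MvPolynomial.X 1) (z v : ℂ × ℂ) :
    F.leg z v = c * radialWeb a b h z v := by
  have haff : ∀ x y : ℂ,
      MvPolynomial.eval ![x, y, 1] (F.coeff 0) - x * MvPolynomial.eval ![x, y, 1] (F.coeff 2) =
        c * (binaryCubic a (x, y) + binaryCubic h (x, y) * x) ∧
      MvPolynomial.eval ![x, y, 1] (F.coeff 1) - y * MvPolynomial.eval ![x, y, 1] (F.coeff 2) =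
        c * (binaryCubic b (x, y) + binaryCubic h (x, y) * y) := fun x y => by
    have e0 := congrArg (MvPolynomial.eval ![x, y]) (congrFun hF 0)
    have e1 := congrArg (MvPolynomial.eval ![x, y]) (congrFun hF 1)
    simp only [affineField, Pi.smul_apply, h0, h1, Matrix.cons_val_zero, Matrix.cons_val_one,
      map_sub, map_mul, MvPolynomial.eval_X, eval_dehomogenize, MvPolynomial.smul_eval, map_add,
      eval_cubicPolynomial] at e0 e1
    exact ⟨e0, e1⟩
  have hcross : ∀ v : ℂ × ℂ, ![z.1, -1, z.2] ⨯₃ ![v.1, 0, v.2] =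
      ![-v.2, z.2 * v.1 - z.1 * v.2, v.1] := fun v => by
    rw [cross_apply]
    ext i
    fin_cases i <;> simp
  have hleg : ∀ v : ℂ × ℂ, F.leg z v =
      z.1 * MvPolynomial.eval ![-v.2, z.2 * v.1 - z.1 * v.2, v.1] (F.coeff 0) -
        MvPolynomial.eval ![-v.2, z.2 * v.1 - z.1 * v.2, v.1] (F.coeff 1) +
        z.2 * MvPolynomial.eval ![-v.2, z.2 * v.1 - z.1 * v.2, v.1] (F.coeff 2) := fun v => by
    simp only [leg, legendreForm, hcross, Fin.sum_univ_three]
    simp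
    ring
  -- The affine computation needs `dp ≠ 0`; continuity in `v` gives the rest.
  have hdense : Dense {v : ℂ × ℂ | v.1 ≠ 0} := by
    have : {v : ℂ × ℂ | v.1 ≠ 0} = ({0}ᶜ : Set ℂ) ×ˢ Set.univ := by ext; simp
    rw [this]
    exact (dense_compl_singleton 0).prod dense_univ
  have hcont : Continuous (fun v : ℂ × ℂ => F.leg z v) := by
    have hv : Continuous fun v : ℂ × ℂ => ![-v.2, z.2 * v.1 - z.1 * v.2, v.1] := by
      refine continuous_pi fun i => ?_
      fin_cases i <;> simp <;> fun_prop
    simp only [hleg]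
    have k := fun i => (MvPolynomial.continuous_eval (F.coeff i)).comp hv
    exact ((continuous_const.mul (k 0)).sub (k 1)).add (continuous_const.mul (k 2))
  have hcont' : Continuous (fun v : ℂ × ℂ => c * radialWeb a b h z v) := by
    unfold radialWeb binaryCubic
    fun_prop
  refine congrFun (hcont.ext_on hdense hcont' fun v hv => ?_) v
  have hv' : v.1 ≠ 0 := hv
  obtain ⟨x, hx⟩ : ∃ x, -v.2 = v.1 * x := ⟨-v.2 / v.1, by field_simp⟩
  have hm : ![-v.2, z.2 * v.1 - z.1 * v.2, v.1] = v.1 • ![x, z.1 * x + z.2, 1] := by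
    ext i
    fin_cases i
    · simpa using hx
    · simp
      linear_combination z.1 * hx
    · simp
  have hb : binaryCubic (z.1 • a - b - z.2 • h) (-v.2, z.2 * v.1 - z.1 * v.2) =
      v.1 ^ 3 * (z.1 * binaryCubic a (x, z.1 * x + z.2) - binaryCubic b (x, z.1 * x + z.2) -
        z.2 * binaryCubic h (x, z.1 * x + z.2)) := by
    have e : z.2 * v.1 - z.1 * v.2 = v.1 * (z.1 * x + z.2) := by linear_combination z.1 * hx
    rw [e, hx]
    simp only [binaryCubic, Pi.sub_apply, Pi.smul_apply, smul_eq_mul]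
    ring
  simp only [hleg, radialWeb]
  rw [hm, eval_smul_of_isHomogeneous (F.homogeneous 0), eval_smul_of_isHomogeneous (F.homogeneous 1),
    eval_smul_of_isHomogeneous (F.homogeneous 2), hb]
  obtain ⟨e0, e1⟩ := haff x (z.1 * x + z.2)
  linear_combination v.1 ^ 3 * z.1 * e0 - v.1 ^ 3 * e1

end PlaneFoliation

-- The exceptional points grow at most by the finitely many `p` for which `p a - b` has a multiple
-- root. Since `h` and `h'` are arbitrary, both directions of the theorem are instances, one of the
-- two cubics being 0.
open PlaneWeb in
theorem PlaneWeb.curvatureHolomorphicAtGenericPoint_radialWeb {a b h h' : Fin 4 → ℂ} {c c' : ℂ}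
    (hc : c ≠ 0) (hc' : c' ≠ 0) (hab : ∀ v, v ≠ 0 → ¬ (IsCriticalPoint a v ∧ IsCriticalPoint b v))
    (hW : CurvatureHolomorphicAtGenericPoint (fun z v => c * radialWeb a b h z v)
      (dualLine (0, 0))) :
    CurvatureHolomorphicAtGenericPoint (fun z v => c' * radialWeb a b h' z v)
      (dualLine (0, 0)) := by
  refine (hW.union ((finite_pencil_isCriticalPoint hab).image fun p => (p, (0 : ℂ)))).subset ?_
  rintro ⟨p, q⟩ ⟨hm, hnot⟩
  obtain rfl : q = 0 := by simpa [dualLine] using hm.symm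
  by_cases hp : ∃ v, v ≠ 0 ∧ IsCriticalPoint (p • a - b) v
  · exact Or.inr ⟨p, hp, rfl⟩
  · push Not at hp
    exact Or.inl ⟨hm, fun hhol => hnot (curvatureHolomorphicAt_radialWeb hc hc' hp hhol)⟩

theorem mainTheorem8
    (X₃ : Fin 2 → MvPolynomial (Fin 2) ℂ) (hX₃ : ∀ i, (X₃ i).IsHomogeneous 3)
    (hsq : NoMultipleSingularComponents X₃)
    (H : MvPolynomial (Fin 2) ℂ) (hH : H.IsHomogeneous 3)
    (F Fh : PlaneFoliation 3)
    (hF : F.IsInducedBy (fun i => X₃ i + H * MvPolynomial.X i))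
    (hFh : Fh.IsInducedBy X₃) :
    PlaneWeb.CurvatureHolomorphicAtGenericPoint F.leg (PlaneWeb.dualLine (0, 0)) ↔
      PlaneWeb.CurvatureHolomorphicAtGenericPoint Fh.leg (PlaneWeb.dualLine (0, 0)) := by
  obtain ⟨a, ha⟩ := PlaneWeb.exists_eq_cubicPolynomial (hX₃ 0)
  obtain ⟨b, hb⟩ := PlaneWeb.exists_eq_cubicPolynomial (hX₃ 1)
  obtain ⟨h, hh⟩ := PlaneWeb.exists_eq_cubicPolynomial hH
  obtain ⟨c, hc, hcF⟩ := hF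
  obtain ⟨c', hc', hcF'⟩ := hFh
  have hab : ∀ v, v ≠ 0 → ¬ (PlaneWeb.IsCriticalPoint a v ∧ PlaneWeb.IsCriticalPoint b v) := by
    rintro v hv ⟨h1, h2⟩
    obtain ⟨L, hL, hdvd⟩ := PlaneWeb.sq_dvd_cubicPolynomial_of_isCriticalPoint hv
    refine hL (hsq L fun i => ?_)
    fin_cases i
    · exact ha ▸ hdvd a h1
    · exact hb ▸ hdvd b h2
  have hzero : PlaneWeb.cubicPolynomial 0 = 0 := by simp [PlaneWeb.cubicPolynomial]
  have e1 : F.leg = fun z v => c * PlaneWeb.radialWeb a b h z v := by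
    funext z v
    exact PlaneFoliation.leg_eq_radialWeb hcF (by rw [ha, hh]) (by rw [hb, hh]) z v
  have e2 : Fh.leg = fun z v => c' * PlaneWeb.radialWeb a b 0 z v := by
    funext z v
    exact PlaneFoliation.leg_eq_radialWeb hcF' (by rw [ha, hzero, zero_mul, add_zero])
      (by rw [hb, hzero, zero_mul, add_zero]) z v
  rw [e1, e2]
  exact ⟨PlaneWeb.curvatureHolomorphicAtGenericPoint_radialWeb hc hc' hab,
    PlaneWeb.curvatureHolomorphicAtGenericPoint_radialWeb hc' hc hab⟩
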